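/- **Conventions.** Let $k$ be a field and let $\mathbb O$ be a small strict operadic category in the sense of Batanin and Markl: it has a cardinality functor $|-|$ to the skeletal category of finite sets, a chosen terminal object $U_c$ with $|U_c|=1$ in each connected component $c$, and fiber functors $\mathbb O/S\to\mathbb O$, $f\mapsto f^{-1}(i)$ $(i\in|S|)$, satisfying the usual axioms. An object is trivial if it is some $U_c$; a morphism is a quasibijection if all its fibers are trivial, and order preserving if $|f|$ is. Assume that - $\mathbb O$ is graded: there is $e\colon \mathrm{Ob}\,\mathbb O\to\mathbb N$ with $e(T)=e(S)+\sum_{i\in|S|}e(f^{-1}(i))$ for all $f\colon T\to S$; the grade of $f$ is $e(T)-e(S)$; - $\mathbb O$ is factorizable: every morphism is a quasibijection followed by an order preserving morphism; - all quasibijections are invertible; - the strong blow-up axiom holds: given an order preserving $f'\colon S'\to T'$, a quasibijection $\sigma\colon T'\to T''$, objects $F_j$ $(j\in|T''|)$ and maps $\pi_i\colon f'^{-1}(i)\to F_{|\sigma|(i)}$ $(i\in |T'|)$, there are a unique $\pi\colon S'\to S''$ and a unique order preserving $f''\colon S''\to T''$ with $\sigma f'=f''\pi$ such that $f''$ has the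 fibers $F_j$ and $\pi$ induces the $\pi_i$ on the fibers; - the unique fiber axiom holds: if $|S|=1$ and the fiber of $f\colon T\to S$ is $T$, then $S$ is trivial; - a morphism is an isomorphism if and only if its grade is $0$. An elementary morphism $\phi\colon F\triangleright_i T\to S$ is an order preserving morphism $T\to S$ whose fiber over $i\in|S|$ is $F$, with $e(F)\ge1$, and whose other fibers are trivial. Let $\mathbb O_{iso}$ be the groupoid of isomorphisms of $\mathbb O$. *Squares.* We consider commutative squares $\sigma\phi'=\phi''\omega$ with $\phi'\colon F'\triangleright T'\to S'$ and $\phi''\colon F''\triangleright T''\to S''$ elementary, $\omega\colon T'\to T''$ an isomorphism and $\sigma\colon S'\to S''$ a quasibijection; they induce an isomorphism $\overline\omega\colon F'\to F''$. *Sequential pairs.* For $\phi\colon F\triangleright_jT\to S$ and $\psi\colon G\triangleright_iS\to P$ elementary with $|\psi|(j)=i$, let $\xi=\psi\phi\colon H\triangleright_iT\to P$ be the elementary composite and $\phi_i\colon F\triangleright H\to G$ the induced elementary morphism of the fibers over $i$. *Parallel squares.* We consider commutative squares $\psi'\phi'=\psi''\phi''$ of elementary morphisms $\phi'\colon F'\triangleright_{j'}T\to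 P'$, $\psi'\colon F''\triangleright_{i'}P'\to S$, $\phi''\colon F''\triangleright_{j''}T\to P''$, $\psi''\colon F'\triangleright_{i''}P''\to S$ with disjoint fibers, i.e. $|\psi'|(j')=i''$, $|\psi''|(j'')=i'$ and $i'\neq i''$. **Markl operads.** A non-unital Markl $\mathbb O$-operad in $\mathit{Vect}_k$ is a functor $M\colon\mathbb O_{iso}^{op}\to\mathit{Vect}_k$ with linear maps $\circ_\phi\colon M(S)\otimes M(F)\to M(T)$, one for each elementary $\phi\colon F\triangleright T\to S$, such that - $M(\omega)\,\circ_{\phi''}=\circ_{\phi'}\,(M(\sigma)\otimes M(\overline\omega))$ for every square as above; - $\circ_\phi(\circ_\psi(p,g),f)=\circ_\xi(p,\circ_{\phi_i}(g,f))$ for every sequential pair; - $\circ_{\phi'}(\circ_{\psi'}(s,f''),f')=\circ_{\phi''}(\circ_{\psi''}(s,f'),f'')$ for every parallel square. Morphisms are natural transformations commuting with all $\circ_\phi$. **Colored operads.** For a small category $C$, a non-symmetric $C$-collection is a family of functors $(C^{op})^{n}\times C\to\mathit{Vect}_k$, $n\ge0$. A $C$-operad (non-unital) is a functor $P\colon(\mathbb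 SC)^{op}\times C\to\mathit{Vect}_k$, where $\mathbb SC$ is the free symmetric monoidal category on $C$, with compositions $\circ_i\colon P(c_1\cdots c_n;c)\otimes P(d_1\cdots d_m;c_i)\to P(c_1\cdots c_{i-1}d_1\cdots d_m c_{i+1}\cdots c_n;c)$ which are natural in all free colors, form a cowedge in $c_i$, are equivariant under permutations and satisfy sequential and parallel associativity. For $A\colon C\to\mathit{Vect}_k$ let $\mathrm{End}_A(c_1\cdots c_n;c)=\mathrm{Hom}_k(A(c_1)\otimes\cdots\otimes A(c_n),A(c))$. A $P$-algebra is a functor $A\colon C\to\mathit{Vect}_k$ with a morphism of $C$-operads $P\to\mathrm{End}_A$; morphisms of algebras are natural transformations commuting with all operations. A $C$-operad is binary quadratic if it is isomorphic to $F(Q)/(R)$, where $F(Q)$ is the free $C$-operad on a non-symmetric $C$-collection $Q$ with $Q_n=0$ for $n\ne2$, and $(R)$ is the operadic ideal generated by a set $R$ of elements of weight $2$, i.e. linear combinations of composites of two generators. **The operad $\mathbb H_{\mathbb O}$.** Take $C=\mathbb O_{iso}^{op}$. Let $X$ be the left Kan extension, from objects to all of $\bigoplus_n (C^{op})^n\times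 C$, of the collection whose value on $(S\,F;T)$ is the vector space spanned by symbols $*_\phi$, one for each elementary $\phi\colon F\triangleright T\to S$, and which vanishes otherwise. Thus $X(S'\,F';T')$ has as basis the elements $(*_\phi,\sigma\,\tau;\pi)$ with $\phi\colon F\triangleright T\to S$ elementary and $\sigma\colon S'\to S$, $\tau\colon F'\to F$, $\pi\colon T\to T'$ morphisms of $C$, on which morphisms of $C$ act by composition. Let $Q=X/\mathit{Eq}$, where $\mathit{Eq}$ is the equivalence relation generated by $$(*_{\phi''},\mathbb 1\,\mathbb 1;\omega)\sim(*_{\phi'},\sigma\,\overline\omega;\mathbb 1)$$ for all squares as above (with $\omega,\sigma,\overline\omega$ regarded as morphisms $T''\to T'$, $S''\to S'$, $F''\to F'$ of $C$). Let $[*_\phi]\in F(Q)(S\,F;T)$ be the class of $(*_\phi,\mathbb 1\,\mathbb 1;\mathbb 1)$. Put $\mathbb H_{\mathbb O}=F(Q)/\mathit{As}$, where $\mathit{As}$ is the operadic ideal generated by the sequential associators $$[*_\phi]\circ_1[*_\psi]-[*_\xi]\circ_2[*_{\phi_i}]\in F(Q)(P\,G\,F;T)$$ for all sequential pairs, and the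 parallel associators $$[*_{\phi'}]\circ_1[*_{\psi'}]-\tau([*_{\phi''}]\circ_1[*_{\psi''}])\in F(Q)(S\,F''\,F';T)$$ for all parallel squares, where $\tau$ swaps the second and third input. **Theorem B2.** The $\mathbb O_{iso}^{op}$-operad $\mathbb H_{\mathbb O}$ is binary quadratic, and the category of $\mathbb H_{\mathbb O}$-algebras is isomorphic (not merely equivalent) to the category of non-unital Markl $\mathbb O$-operads in $\mathit{Vect}_k$. -/

import Mathlib

open CategoryTheory Opposite
open scoped CategoryTheory.Prod

universe u

namespace HyperOp

/-! ### Operadic categories -/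

/-- The data underlying a (strict) operadic category: a cardinality functor to the skeletal
category of finite sets `{1, …, n}` and all maps (here `Fin n`), a choice of an object in every
connected component, and for every object `R` and every `i ∈ |R|` a functor `Fib_i : O/R ⥤ O`. -/
class OperadicData (O : Type u) [SmallCategory O] where
  /-- `|T|` -/
  card : O → ℕ
  /-- `|f| : |T| → |S|` -/
  cardMap {T S : O} (f : T ⟶ S) : Fin (card T) → Fin (card S)
  cardMap_id (T : O) : cardMap (𝟙 T) = id
  cardMap_comp {T S R : O} (f : T ⟶ S) (g : S ⟶ R) : cardMap (f ≫ g) = cardMap g ∘ cardMap f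
  /-- the chosen objects `U_c`, `c ∈ π₀(O)` -/
  U : ConnectedComponents O → O
  /-- the fiber functors -/
  fib (R : O) (i : Fin (card R)) : Over R ⥤ O
  /-- `|f⁻¹(i)| = |f|⁻¹(i)` as objects of the skeletal category -/
  card_fib {R : O} (f : Over R) (i : Fin (card R)) :
    (Finset.univ.filter fun j => cardMap f.hom j = i).card = card ((fib R i).obj f)

section OperadicData

variable {O : Type u} [SmallCategory O] [OperadicData O]

/-- `|T|` -/
abbrev card (T : O) : ℕ := OperadicData.card T

/-- `|f|` -/
abbrev cardMap {T S : O} (f : T ⟶ S) : Fin (card T) → Fin (card S) := OperadicData.cardMap f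

/-- The fiber `f⁻¹(i)` of a morphism `f : T ⟶ S` over `i ∈ |S|`. -/
abbrev fiber {T S : O} (f : T ⟶ S) (i : Fin (card S)) : O :=
  (OperadicData.fib S i).obj (Over.mk f)

/-- The map `f_i : (f ≫ g)⁻¹(i) ⟶ g⁻¹(i)` induced by `f` on the fibers over `i`. -/
abbrev fiberMap {T S R : O} (f : T ⟶ S) (g : S ⟶ R) (i : Fin (card R)) :
    fiber (f ≫ g) i ⟶ fiber g i :=
  (OperadicData.fib R i).map (Over.homMk f : Over.mk (f ≫ g) ⟶ Over.mk g)

/-- The identification, as ordered sets, of `|f⁻¹(i)|` with the preimage of `i` under `|f|`. -/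
def fiberEmb {T S : O} (f : T ⟶ S) (i : Fin (card S)) : Fin (card (fiber f i)) ↪o Fin (card T) :=
  Finset.orderEmbOfFin (Finset.univ.filter fun j => cardMap f j = i)
    (OperadicData.card_fib (Over.mk f) i)

/-- The element of `|f⁻¹(i)|` which corresponds to `j ∈ |T|` with `|f|(j) = i`. -/
noncomputable def fiberIdx {T S : O} (f : T ⟶ S) (i : Fin (card S)) (j : Fin (card T))
    (h : cardMap f j = i) : Fin (card (fiber f i)) :=
  (Finset.orderIsoOfFin (Finset.univ.filter fun j => cardMap f j = i)
    (OperadicData.card_fib (Over.mk f) i)).symm ⟨j, by simpa using h⟩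

/-- A morphism `c : Q ⟶ R` and `i ∈ |R|` induce a functor `O/Q ⥤ O/c⁻¹(i)`, which sends
`g : S ⟶ Q` to `g_i : (g ≫ c)⁻¹(i) ⟶ c⁻¹(i)`, and is given by `Fib_i` on morphisms. -/
def fibOver {Q R : O} (c : Q ⟶ R) (i : Fin (card R)) : Over Q ⥤ Over (fiber c i) where
  obj g := Over.mk (fiberMap g.hom c i)
  map {g g'} h := Over.homMk
    ((OperadicData.fib R i).map
      (Over.homMk h.left (by simp) : Over.mk (g.hom ≫ c) ⟶ Over.mk (g'.hom ≫ c)))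
    (by
      simp only [Over.mk_hom, fiberMap, ← Functor.map_comp]
      congr 1
      ext
      simp)
  map_id g := by
    ext
    simp only [Over.homMk_left, Over.id_left]
    exact (OperadicData.fib R i).map_id _
  map_comp {g g' g''} h h' := by
    ext
    simp only [Over.homMk_left, Over.comp_left, ← Functor.map_comp]
    congr 1

/-- An object is trivial if it is one of the chosen objects `U_c`. -/
def IsTrivial (T : O) : Prop := ∃ c : ConnectedComponents O, T = OperadicData.U c

/-- A quasibijection: all fibers are trivial. -/
def IsQuasibijection {T S : O} (f : T ⟶ S) : Prop := ∀ i, IsTrivial (fiber f i)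

/-- A morphism is order preserving if `|f|` is. -/
def OrderPreserving {T S : O} (f : T ⟶ S) : Prop := Monotone (cardMap f)

end OperadicData

/-- A (strict) operadic category. -/
class OperadicCategory (O : Type u) [SmallCategory O] extends OperadicData O where
  /-- `U_c` lies in the component `c` … -/
  U_mem (c : ConnectedComponents O) : (Quotient.mk _ (U c) : ConnectedComponents O) = c
  /-- … and is terminal in it. -/
  U_terminal (T : O) : Nonempty (Unique (T ⟶ U (Quotient.mk _ T : ConnectedComponents O)))
  /-- `|U_c| = 1` -/
  card_U (c : ConnectedComponents O) : card (U c) = 1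
  /-- identities are quasibijections -/
  fiber_id (T : O) : IsQuasibijection (𝟙 T)
  /-- the map `|f_i|` is the map of preimages induced by `|f|` -/
  cardMap_fib {R : O} {f g : Over R} (h : f ⟶ g) (i : Fin (card R))
    (j : Fin (card ((fib R i).obj f))) :
    cardMap h.left (fiberEmb f.hom i j) = fiberEmb g.hom i (cardMap ((fib R i).map h) j)
  /-- the fiber functor over `U_c` is the domain functor -/
  fib_U (c : ConnectedComponents O) (i : Fin (card (U c))) : fib (U c) i = Over.forget (U c)
  /-- On objects: `g⁻¹(j) = g_i⁻¹(j)` for `g : S ⟶ Q`, `c : Q ⟶ R` and `|c|(j) = i`.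
  On morphisms: `f_j = (f_i)_j` for `f : T ⟶ S`, `g : S ⟶ Q`, `c : Q ⟶ R` and `|c|(j) = i`. -/
  fib_fib {Q R : O} (c : Q ⟶ R) (i : Fin (card R)) (j : Fin (card (fiber c i))) :
    fib Q (fiberEmb c i j) = fibOver c i ⋙ fib (fiber c i) j

/-- A grading of an operadic category. -/
class GradedOperadicCategory (O : Type u) [SmallCategory O] extends OperadicCategory O where
  /-- the grade of an object -/
  grade : O → ℕ
  grade_eq {T S : O} (f : T ⟶ S) : grade T = grade S + ∑ i, grade (fiber f i)

section Fibers

variable {O : Type u} [SmallCategory O]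

lemma fiberEmb_mem [OperadicData O] {T S : O} (f : T ⟶ S) (i : Fin (card S))
    (j : Fin (card (fiber f i))) : cardMap f (fiberEmb f i j) = i := by
  have := Finset.orderEmbOfFin_mem (Finset.univ.filter fun j => cardMap f j = i)
    (OperadicData.card_fib (Over.mk f) i) j
  exact (Finset.mem_filter.mp this).2

lemma fiberEmb_fiberIdx [OperadicData O] {T S : O} (f : T ⟶ S) (i : Fin (card S))
    (j : Fin (card T)) (h : cardMap f j = i) : fiberEmb f i (fiberIdx f i j h) = j := by
  unfold fiberEmb fiberIdx
  rw [← Finset.coe_orderIsoOfFin_apply]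
  simp

variable [OperadicCategory O]

lemma fib_of_isTrivial {X : O} (hX : IsTrivial X) (i : Fin (card X)) :
    OperadicData.fib X i = Over.forget X := by
  obtain ⟨c, rfl⟩ := hX
  exact OperadicCategory.fib_U c i

lemma fiber_fiberMap {T S R : O} (f : T ⟶ S) (g : S ⟶ R) (i : Fin (card R))
    (j : Fin (card (fiber g i))) : fiber (fiberMap f g i) j = fiber f (fiberEmb g i j) :=
  (Functor.congr_obj (OperadicCategory.fib_fib g i j) (Over.mk f)).symm

/-- If the fiber of `g` over `|g|(j)` is trivial, then `(f ≫ g)⁻¹(|g|(j)) = f⁻¹(j)`. -/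
lemma fiber_comp_of_isTrivial {T S R : O} (f : T ⟶ S) (g : S ⟶ R) (j : Fin (card S))
    (h : IsTrivial (fiber g (cardMap g j))) : fiber (f ≫ g) (cardMap g j) = fiber f j := by
  have h1 := fiber_fiberMap f g (cardMap g j) (fiberIdx g _ j rfl)
  rw [fiberEmb_fiberIdx] at h1
  rw [← h1]
  exact (Functor.congr_obj (fib_of_isTrivial h _) (Over.mk (fiberMap f g (cardMap g j)))).symm

/-- In a commutative square `f' ≫ σ = ω ≫ f''` with a quasibijection `σ`, the map `ω` induces a
map between the fiber of `f'` over `i` and the fiber of `f''` over `|σ|(i)`. -/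
def inducedMap {T' T'' S' S'' : O} (f' : T' ⟶ S') (σ : S' ⟶ S'') (ω : T' ⟶ T'') (f'' : T'' ⟶ S'')
    (hσ : IsQuasibijection σ) (w : f' ≫ σ = ω ≫ f'') (i : Fin (card S')) :
    fiber f' i ⟶ fiber f'' (cardMap σ i) :=
  eqToHom (fiber_comp_of_isTrivial f' σ i (hσ _)).symm ≫
    (OperadicData.fib S'' (cardMap σ i)).map
      (Over.homMk ω w.symm : Over.mk (f' ≫ σ) ⟶ Over.mk f'')

/-- As `inducedMap`, for an isomorphism `ω`. -/
def inducedIso {T' T'' S' S'' : O} (f' : T' ⟶ S') (σ : S' ⟶ S'') (ω : T' ≅ T'') (f'' : T'' ⟶ S'')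
    (hσ : IsQuasibijection σ) (w : f' ≫ σ = ω.hom ≫ f'') (i : Fin (card S')) :
    fiber f' i ≅ fiber f'' (cardMap σ i) :=
  eqToIso (fiber_comp_of_isTrivial f' σ i (hσ _)).symm ≪≫
    (OperadicData.fib S'' (cardMap σ i)).mapIso
      (Over.isoMk ω w.symm : Over.mk (f' ≫ σ) ≅ Over.mk f'')

lemma inducedIso_hom {T' T'' S' S'' : O} (f' : T' ⟶ S') (σ : S' ⟶ S'') (ω : T' ≅ T'')
    (f'' : T'' ⟶ S'') (hσ : IsQuasibijection σ) (w : f' ≫ σ = ω.hom ≫ f'')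
    (i : Fin (card S')) :
    (inducedIso f' σ ω f'' hσ w i).hom = inducedMap f' σ ω.hom f'' hσ w i := rfl

lemma fiberMap_orderPreserving {T S R : O} (f : T ⟶ S) (g : S ⟶ R) (i : Fin (card R))
    (hf : OrderPreserving f) : OrderPreserving (fiberMap f g i) := by
  intro a b hab
  have h := OperadicCategory.cardMap_fib (Over.homMk f : Over.mk (f ≫ g) ⟶ Over.mk g) i
  have h2 : fiberEmb g i (cardMap (fiberMap f g i) a) ≤
      fiberEmb g i (cardMap (fiberMap f g i) b) := by
    have ha := h a
    have hb := h b
    simp only [Over.homMk_left] at ha hb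
    refine (ha.symm.le.trans ?_).trans hb.le
    exact hf ((fiberEmb (f ≫ g) i).monotone hab)
  exact (fiberEmb g i).le_iff_le.mp h2

end Fibers

/-- The assumptions on a graded operadic category under which Markl operads are considered. -/
structure IsBataninMarkl (O : Type u) [SmallCategory O] [GradedOperadicCategory O] : Prop where
  /-- every morphism is a quasibijection followed by an order preserving morphism -/
  factorizable {T S : O} (f : T ⟶ S) : ∃ (R : O) (σ : T ⟶ R) (φ : R ⟶ S),
    IsQuasibijection σ ∧ OrderPreserving φ ∧ σ ≫ φ = f
  /-- quasibijections are invertible -/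
  quasibijection_isIso {T S : O} (f : T ⟶ S) : IsQuasibijection f → IsIso f
  /-- Strong blow-up: for an order preserving `f' : S' ⟶ T'`, a quasibijection `σ : T' ⟶ T''` and
  maps `π_i : f'⁻¹(i) ⟶ F''_{|σ|(i)}`, there is a unique commutative square `f' ≫ σ = π ≫ f''` with
  an order preserving `f''` whose fibers are the `F''_j`, such that `π` induces the maps `π_i`. -/
  strong_blow_up {S' T' T'' : O} (f' : S' ⟶ T') (σ : T' ⟶ T'') (_ : OrderPreserving f')
    (hσ : IsQuasibijection σ) (F : Fin (card T'') → O)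
    (π : ∀ i : Fin (card T'), fiber f' i ⟶ F (cardMap σ i)) :
    ∃! p : Σ S'' : O, (S' ⟶ S'') × (S'' ⟶ T''), OrderPreserving p.2.2 ∧
      ∃ (w : f' ≫ σ = p.2.1 ≫ p.2.2) (hF : ∀ j, fiber p.2.2 j = F j),
        ∀ i, inducedMap f' σ p.2.1 p.2.2 hσ w i ≫ eqToHom (hF _) = π i
  /-- Unique fiber: if the only fiber of `f : T ⟶ S` is `T`, then `S` is trivial. -/
  unique_fiber {T S : O} (f : T ⟶ S) : card S = 1 → (∀ i, fiber f i = T) → IsTrivial S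
  /-- the isomorphisms are the morphisms of grade `0` -/
  isIso_iff {T S : O} (f : T ⟶ S) : IsIso f ↔
    GradedOperadicCategory.grade T = GradedOperadicCategory.grade S

/-! ### Elementary morphisms -/

section Elementary

variable {O : Type u} [SmallCategory O] [GradedOperadicCategory O]

/-- An elementary morphism `φ : F ▷_i T ⟶ S`: an order preserving morphism whose fiber over `i` is
`F`, of grade at least one, and whose other fibers are trivial. -/
structure Elementary (F T S : O) where
  /-- the morphism -/
  hom : T ⟶ S
  /-- the index `i` of the nontrivial fiber -/
  idx : Fin (card S)
  orderPreserving : OrderPreserving hom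
  fiber_eq : fiber hom idx = F
  one_le_grade : 1 ≤ GradedOperadicCategory.grade F
  isTrivial_fiber : ∀ k, k ≠ idx → IsTrivial (fiber hom k)

lemma grade_of_isTrivial {X : O} (hX : IsTrivial X) : GradedOperadicCategory.grade X = 0 := by
  obtain ⟨c, rfl⟩ := hX
  have h := GradedOperadicCategory.grade_eq (𝟙 (OperadicData.U c : O))
  have hc := OperadicCategory.card_U (O := O) c
  have h0 : ∀ i, fiber (𝟙 (OperadicData.U c : O)) i = OperadicData.U c := fun i =>
    Functor.congr_obj (OperadicCategory.fib_U c i) (Over.mk (𝟙 _))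
  have hs : ∑ i, GradedOperadicCategory.grade (fiber (𝟙 (OperadicData.U c : O)) i) =
      GradedOperadicCategory.grade (OperadicData.U c : O) := by
    simp only [h0, Finset.sum_const, Finset.card_univ, Fintype.card_fin, smul_eq_mul]
    exact (congrArg (· * _) hc).trans (one_mul _)
  omega

lemma grade_eq_of_iso {X Y : O} (e : X ≅ Y) :
    GradedOperadicCategory.grade X = GradedOperadicCategory.grade Y := by
  have h := GradedOperadicCategory.grade_eq e.hom
  have h' := GradedOperadicCategory.grade_eq e.inv
  omega

namespace Elementary

/-- In a square `φ' ≫ σ = ω ≫ φ''` with `φ', φ''` elementary, `σ` a quasibijection and `ω` an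
isomorphism, the indices of the nontrivial fibers correspond to each other. -/
lemma idx_square {F' T' S' F'' T'' S'' : O} (φ' : Elementary F' T' S')
    (φ'' : Elementary F'' T'' S'') (ω : T' ≅ T'') (σ : S' ⟶ S'') (hσ : IsQuasibijection σ)
    (w : φ'.hom ≫ σ = ω.hom ≫ φ''.hom) : cardMap σ φ'.idx = φ''.idx := by
  by_contra hne
  have h1 := grade_eq_of_iso (inducedIso φ'.hom σ ω φ''.hom hσ w φ'.idx)
  have h2 := grade_of_isTrivial (φ''.isTrivial_fiber _ hne)
  have h3 := φ'.one_le_grade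
  rw [← φ'.fiber_eq] at h3
  omega

/-- The isomorphism `F' ≅ F''` between the nontrivial fibers of elementary morphisms `φ', φ''`,
which is induced by a square `φ' ≫ σ = ω ≫ φ''` with `σ` a quasibijection and `ω` an isomorphism. -/
def fiberIso {F' T' S' F'' T'' S'' : O} (φ' : Elementary F' T' S')
    (φ'' : Elementary F'' T'' S'') (ω : T' ≅ T'') (σ : S' ⟶ S'') (hσ : IsQuasibijection σ)
    (w : φ'.hom ≫ σ = ω.hom ≫ φ''.hom) : F' ≅ F'' :=
  eqToIso φ'.fiber_eq.symm ≪≫ inducedIso φ'.hom σ ω φ''.hom hσ w φ'.idx ≪≫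
    eqToIso (by rw [idx_square φ' φ'' ω σ hσ w, φ''.fiber_eq])

/-- Transport of an elementary morphism along an equality of targets. -/
def ofTargetEq {F T S S' : O} (φ : Elementary F T S) (h : S = S') : Elementary F T S' := h ▸ φ

/-- For elementary `φ : F ▷_j T ⟶ S` and `ψ : G ▷_i S ⟶ P` with `|ψ|(j) = i`, the elementary map
`φ_i : F ▷ H ⟶ G` induced between the fibers over `i`, where `H` is the fiber of `φ ≫ ψ`. -/
noncomputable def onFiber {F T S G P : O} (φ : Elementary F T S) (ψ : Elementary G S P)
    (h : cardMap ψ.hom φ.idx = ψ.idx) : Elementary F (fiber (φ.hom ≫ ψ.hom) ψ.idx) G :=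
  ofTargetEq
    { hom := fiberMap φ.hom ψ.hom ψ.idx
      idx := fiberIdx ψ.hom ψ.idx φ.idx h
      orderPreserving := fiberMap_orderPreserving _ _ _ φ.orderPreserving
      fiber_eq := by rw [fiber_fiberMap, fiberEmb_fiberIdx, φ.fiber_eq]
      one_le_grade := φ.one_le_grade
      isTrivial_fiber := fun k hk => by
        rw [fiber_fiberMap]
        refine φ.isTrivial_fiber _ fun hk' => hk ?_
        apply (fiberEmb ψ.hom ψ.idx).injective
        rw [hk', fiberEmb_fiberIdx] }
    ψ.fiber_eq

/-- The elementary composite `ξ = φ ≫ ψ : H ▷_i T ⟶ P` of elementary morphisms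
`φ : F ▷_j T ⟶ S` and `ψ : G ▷_i S ⟶ P` with `|ψ|(j) = i`. -/
def comp {F T S G P : O} (φ : Elementary F T S) (ψ : Elementary G S P)
    (h : cardMap ψ.hom φ.idx = ψ.idx) : Elementary (fiber (φ.hom ≫ ψ.hom) ψ.idx) T P where
  hom := φ.hom ≫ ψ.hom
  idx := ψ.idx
  orderPreserving := by
    unfold OrderPreserving cardMap
    rw [OperadicData.cardMap_comp]
    exact ψ.orderPreserving.comp φ.orderPreserving
  fiber_eq := rfl
  one_le_grade := by
    have h1 := GradedOperadicCategory.grade_eq (fiberMap φ.hom ψ.hom ψ.idx)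
    have h2 := ψ.one_le_grade
    rw [← ψ.fiber_eq] at h2
    omega
  isTrivial_fiber k hk := by
    have ht := ψ.isTrivial_fiber k hk
    have hc : card (fiber ψ.hom k) = 1 := by
      obtain ⟨c, hc⟩ := ht
      rw [hc]
      exact OperadicCategory.card_U c
    have hl := fiberEmb_mem ψ.hom k ⟨0, by omega⟩
    generalize fiberEmb ψ.hom k ⟨0, by omega⟩ = l at hl
    subst hl
    rw [fiber_comp_of_isTrivial _ _ _ ht]
    exact φ.isTrivial_fiber l fun e => hk (e ▸ h)

end Elementary

end Elementary

end HyperOp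
namespace HyperOp

/-! ### Category-colored operads -/

section Tuples

variable {C : Type u} [SmallCategory C]

/-- Objects of the free symmetric monoidal category `𝕊C` on `C`: finite lists of objects. -/
structure Tup (C : Type u) where
  len : ℕ
  col : Fin len → C

/-- Morphisms `(c₁ … cₙ) ⟶ (d₁ … dₙ)` of `𝕊C`: a permutation `σ` and maps `cᵢ ⟶ d_{σ(i)}`. -/
@[ext]
structure Tup.Hom (a b : Tup C) where
  perm : Fin a.len ≃ Fin b.len
  map : ∀ i, a.col i ⟶ b.col (perm i)

instance : Category.{u} (Tup C) where
  Hom := Tup.Hom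
  id a := ⟨Equiv.refl _, fun i => 𝟙 (a.col i)⟩
  comp f g := ⟨f.perm.trans g.perm, fun i => f.map i ≫ g.map (f.perm i)⟩
  id_comp f := Tup.Hom.ext rfl (heq_of_eq (funext fun i => Category.id_comp (f.map i)))
  comp_id f := Tup.Hom.ext rfl (heq_of_eq (funext fun i => Category.comp_id (f.map i)))
  assoc _ _ _ := Tup.Hom.ext rfl (heq_of_eq (funext fun _ => Category.assoc _ _ _))

@[simp] lemma Tup.id_perm (a : Tup C) : Tup.Hom.perm (𝟙 a) = Equiv.refl _ := rfl

@[simp] lemma Tup.id_map (a : Tup C) (i : Fin a.len) : Tup.Hom.map (𝟙 a) i = 𝟙 (a.col i) := rfl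

@[simp] lemma Tup.comp_perm {a b c : Tup C} (f : a ⟶ b) (g : b ⟶ c) :
    Tup.Hom.perm (f ≫ g) = (Tup.Hom.perm f).trans (Tup.Hom.perm g) := rfl

@[simp] lemma Tup.comp_map {a b c : Tup C} (f : a ⟶ b) (g : b ⟶ c) (i : Fin a.len) :
    Tup.Hom.map (f ≫ g) i = Tup.Hom.map f i ≫ Tup.Hom.map g (Tup.Hom.perm f i) := rfl

/-- Positions after inserting `m` new places at the place `i` of `n` places (so that there are
`n + m - 1` of them): the new places become `i, …, i + m - 1`, the places before `i` stay, and those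
after `i` are shifted by `m - 1`. -/
def placeFun {n m l : ℕ} (h : l + 1 = n + m) (i : Fin n) : {j : Fin n // j ≠ i} ⊕ Fin m → Fin l
  | Sum.inl j => if hj : j.1 < i then ⟨j.1, by omega⟩ else
      ⟨j.1 + m - 1, by have := j.2; have := j.1.2; omega⟩
  | Sum.inr q => ⟨i + q, by omega⟩

lemma placeFun_bijective {n m l : ℕ} (h : l + 1 = n + m) (i : Fin n) :
    Function.Bijective (placeFun h i) := by
  rw [Fintype.bijective_iff_injective_and_card]
  constructor
  · rintro (⟨j, hj⟩ | q) (⟨j', hj'⟩ | q') e <;> simp only [placeFun, Fin.ext_iff] at e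
    · congr 1
      apply Subtype.ext
      apply Fin.ext
      have := Fin.val_ne_of_ne hj
      have := Fin.val_ne_of_ne hj'
      split_ifs at e with h1 h2 h2 <;> simp only at * <;> omega
    · have := Fin.val_ne_of_ne hj
      exfalso
      split_ifs at e with h1 <;> simp only at * <;> omega
    · have := Fin.val_ne_of_ne hj'
      exfalso
      split_ifs at e with h1 <;> simp only at * <;> omega
    · congr 1
      apply Fin.ext
      omega
  · simp [Fintype.card_subtype_compl]
    have := i.2
    omega

/-- `placeFun` as a bijection. -/
noncomputable def place {n m l : ℕ} (h : l + 1 = n + m) (i : Fin n) :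
    {j : Fin n // j ≠ i} ⊕ Fin m ≃ Fin l :=
  Equiv.ofBijective (placeFun h i) (placeFun_bijective h i)

lemma place_inl_val {n m l : ℕ} (h : l + 1 = n + m) (i : Fin n) (j : {j : Fin n // j ≠ i}) :
    (place h i (Sum.inl j)).1 = if j.1.1 < i.1 then j.1.1 else j.1.1 + m - 1 := by
  simp only [place, Equiv.ofBijective_apply, placeFun, Fin.lt_def]
  split_ifs <;> rfl

lemma place_inr_val {n m l : ℕ} (h : l + 1 = n + m) (i : Fin n) (q : Fin m) :
    (place h i (Sum.inr q)).1 = i.1 + q.1 := rfl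

/-- `IsSplice a i b y t` says that `y` is the `i`-th entry of the list `a`, and that `t` is the list
`a` with this entry replaced by the list `b`. -/
structure IsSplice (a : Tup C) (i : Fin a.len) (b : Tup C) (y : C) (t : Tup C) : Prop where
  len_eq : t.len + 1 = a.len + b.len
  col_eq : a.col i = y
  col_outer : ∀ j : {j : Fin a.len // j ≠ i}, t.col (place len_eq i (Sum.inl j)) = a.col j.1
  col_inner : ∀ q : Fin b.len, t.col (place len_eq i (Sum.inr q)) = b.col q

lemma IsSplice.col_place {C : Type u} {a : Tup C} {i : Fin a.len} {b : Tup C} {y : C} {t : Tup C}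
    (s : IsSplice a i b y t) :
    ∀ z, t.col (place s.len_eq i z) = Sum.elim (fun j => a.col j.1) b.col z
  | Sum.inl j => s.col_outer j
  | Sum.inr q => s.col_inner q

section SpliceHom

variable {a a' b b' t t' : Tup C} {y y' : C} {i : Fin a.len}

/-- The maps `i ↦ σ(i)` on the entries `≠ i` of `a` and on the entries of `b`. -/
def spliceSum (f : a ⟶ a') (g : b ⟶ b') :
    {j : Fin a.len // j ≠ i} ⊕ Fin b.len ≃
      {j : Fin a'.len // j ≠ Tup.Hom.perm f i} ⊕ Fin b'.len :=
  Equiv.sumCongr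
    ((Tup.Hom.perm f).subtypeEquiv fun _ => not_congr (Tup.Hom.perm f).injective.eq_iff.symm)
    (Tup.Hom.perm g)

/-- The components of a pair of morphisms of lists. -/
def spliceSumHom (f : a ⟶ a') (g : b ⟶ b') : ∀ z : {j : Fin a.len // j ≠ i} ⊕ Fin b.len,
    (Sum.elim (fun j => a.col j.1) b.col z : C) ⟶
      Sum.elim (fun j => a'.col j.1) b'.col (spliceSum f g z)
  | Sum.inl j => Tup.Hom.map f j.1
  | Sum.inr q => Tup.Hom.map g q

/-- The `i`-th component of `f : a ⟶ a'`, between the entries which are replaced. -/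
def midHom {t t' : Tup C} (s : IsSplice a i b y t) (f : a ⟶ a')
    (s' : IsSplice a' (Tup.Hom.perm f i) b' y' t') : y ⟶ y' :=
  eqToHom s.col_eq.symm ≫ Tup.Hom.map f i ≫ eqToHom s'.col_eq

/-- Inserting the morphism `g : b ⟶ b'` at the place `i` of `f : a ⟶ a'`: the permutation is
`σ ∘ᵢ τ` for the permutations `σ, τ` of `f, g`, and the components are those of `f` (except for the
`i`-th) and of `g`. -/
noncomputable def spliceHom (s : IsSplice a i b y t) (f : a ⟶ a')
    (s' : IsSplice a' (Tup.Hom.perm f i) b' y' t') (g : b ⟶ b') : t ⟶ t' where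
  perm := (place s.len_eq i).symm.trans
    ((spliceSum f g).trans (place s'.len_eq (Tup.Hom.perm f i)))
  map l :=
    eqToHom (by rw [← s.col_place, Equiv.apply_symm_apply]) ≫
    spliceSumHom f g ((place s.len_eq i).symm l) ≫
    eqToHom (s'.col_place _).symm

end SpliceHom

end Tuples

section Operads

variable (k : Type u) [Field k] (C : Type u) [SmallCategory C]

/-- `C`-collections: functors `(𝕊C)ᵒᵖ × C ⥤ Vect`. -/
abbrev Collection := (Tup C)ᵒᵖ × C ⥤ ModuleCat.{u} k

/-- Non-symmetric `C`-collections: families of functors `(Cᵒᵖ)ⁿ × C ⥤ Vect`. -/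
abbrev NSCollection := ∀ n : ℕ, (Fin n → Cᵒᵖ) × C ⥤ ModuleCat.{u} k

variable {k C}

/-- The value `P(c₁ … cₙ; c)`. -/
abbrev Collection.val (P : Collection k C) (a : Tup C) (x : C) : Type u := P.obj (op a, x)

/-- The action of the morphisms of `(𝕊C)ᵒᵖ × C`. -/
def Collection.act (P : Collection k C) {a b : Tup C} {x y : C} (f : b ⟶ a) (g : x ⟶ y) :
    P.val a x →ₗ[k] P.val b y :=
  (P.map (f.op ×ₘ g)).hom

variable (k C)

/-- A (non-unital) `C`-operad. The composition `∘ᵢ : P(a; x) ⊗ P(b; y) ⟶ P(t; x)` is defined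
whenever `y` is the `i`-th entry of `a` and `t` is `a` with this entry replaced by `b`. -/
structure COperad where
  /-- the underlying collection -/
  coll : Collection k C
  /-- the composition `∘ᵢ` -/
  comp {a : Tup C} {i : Fin a.len} {b : Tup C} {y : C} {t : Tup C} (s : IsSplice a i b y t)
    (x : C) : coll.val a x →ₗ[k] coll.val b y →ₗ[k] coll.val t x
  /-- naturality in the output -/
  comp_act_output {a : Tup C} {i : Fin a.len} {b : Tup C} {y : C} {t : Tup C}
    (s : IsSplice a i b y t) {x x' : C} (g : x ⟶ x') (p : coll.val a x) (q : coll.val b y) :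
    comp s x' (coll.act (𝟙 a) g p) q = coll.act (𝟙 t) g (comp s x p q)
  /-- Naturality in the inputs, the cowedge condition in the color `y` along which the operations
  are composed, and equivariance under permutations. -/
  comp_act_input {a a' b b' t t' : Tup C} {i : Fin a.len} {y y' : C} (s : IsSplice a i b y t)
    (f : a ⟶ a') (s' : IsSplice a' (Tup.Hom.perm f i) b' y' t') (g : b ⟶ b') (x : C)
    (p : coll.val a' x) (q : coll.val b' y) :
    comp s x (coll.act f (𝟙 x) p) (coll.act g (𝟙 y) q) =
      coll.act (spliceHom s f s' g) (𝟙 x) (comp s' x p (coll.act (𝟙 b') (midHom s f s') q))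
  /-- sequential associativity -/
  assoc_seq {a b c t u v : Tup C} {i : Fin a.len} {j : Fin b.len} {y z : C}
    (s₁ : IsSplice a i b y t) (s₂ : IsSplice t (place s₁.len_eq i (Sum.inr j)) c z u)
    (s₃ : IsSplice b j c z v) (s₄ : IsSplice a i v y u) (x : C)
    (p : coll.val a x) (q : coll.val b y) (r : coll.val c z) :
    comp s₂ x (comp s₁ x p q) r = comp s₄ x p (comp s₃ y q r)
  /-- parallel associativity -/
  assoc_par {a b c t u v : Tup C} {i j : Fin a.len} {y z : C} (hij : i ≠ j)
    (s₁ : IsSplice a i b y t) (s₂ : IsSplice t (place s₁.len_eq i (Sum.inl ⟨j, hij.symm⟩)) c z u)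
    (s₃ : IsSplice a j c z v) (s₄ : IsSplice v (place s₃.len_eq j (Sum.inl ⟨i, hij⟩)) b y u)
    (x : C) (p : coll.val a x) (q : coll.val b y) (r : coll.val c z) :
    comp s₂ x (comp s₁ x p q) r = comp s₄ x (comp s₃ x p r) q

variable {k C}

/-- Morphisms of `C`-operads. -/
@[ext]
structure COperad.Hom (P Q : COperad k C) where
  toNatTrans : P.coll ⟶ Q.coll
  map_comp {a : Tup C} {i : Fin a.len} {b : Tup C} {y : C} {t : Tup C} (s : IsSplice a i b y t)
    (x : C) (p : P.coll.val a x) (q : P.coll.val b y) :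
    (toNatTrans.app (op t, x)).hom (P.comp s x p q) =
      Q.comp s x ((toNatTrans.app (op a, x)).hom p) ((toNatTrans.app (op b, y)).hom q)

instance : Category.{u} (COperad k C) where
  Hom := COperad.Hom
  id P := ⟨𝟙 _, fun _ _ _ _ => rfl⟩
  comp f g := ⟨f.toNatTrans ≫ g.toNatTrans, fun s x p q => by
    simp only [NatTrans.comp_app, ModuleCat.hom_comp, LinearMap.comp_apply, f.map_comp,
      g.map_comp]⟩

/-- The value of a morphism of `C`-operads on an operation. -/
def COperad.Hom.apply {P Q : COperad k C} (f : P ⟶ Q) {a : Tup C} {x : C} :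
    P.coll.val a x →ₗ[k] Q.coll.val a x :=
  ((COperad.Hom.toNatTrans f).app (op a, x)).hom

/-! #### Operadic ideals and quotients -/

/-- An operadic ideal of `P`: a subfunctor of the underlying collection of `P` such that a
composition of two operations is in it as soon as one of them is. -/
structure COperad.Ideal (P : COperad k C) where
  carrier (a : Tup C) (x : C) : Submodule k (P.coll.val a x)
  act_mem {a b : Tup C} {x y : C} (f : b ⟶ a) (g : x ⟶ y) {p : P.coll.val a x}
    (hp : p ∈ carrier a x) : P.coll.act f g p ∈ carrier b y
  comp_mem_left {a : Tup C} {i : Fin a.len} {b : Tup C} {y : C} {t : Tup C}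
    (s : IsSplice a i b y t) (x : C) {p : P.coll.val a x} (hp : p ∈ carrier a x)
    (q : P.coll.val b y) : P.comp s x p q ∈ carrier t x
  comp_mem_right {a : Tup C} {i : Fin a.len} {b : Tup C} {y : C} {t : Tup C}
    (s : IsSplice a i b y t) (x : C) (p : P.coll.val a x) {q : P.coll.val b y}
    (hq : q ∈ carrier b y) : P.comp s x p q ∈ carrier t x

/-- The smallest operadic ideal which contains given sets of operations. -/
def COperad.idealSpan (P : COperad k C) (A : ∀ (a : Tup C) (x : C), Set (P.coll.val a x)) :
    P.Ideal where
  carrier a x := ⨅ I : {I : P.Ideal // ∀ a x, A a x ⊆ I.carrier a x}, I.1.carrier a x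
  act_mem := by
    intro a b x y f g p hp
    simp only [Submodule.mem_iInf] at hp ⊢
    exact fun I => I.1.act_mem f g (hp I)
  comp_mem_left := by
    intro a i b y t s x p hp q
    simp only [Submodule.mem_iInf] at hp ⊢
    exact fun I => I.1.comp_mem_left s x (hp I) q
  comp_mem_right := by
    intro a i b y t s x p q hq
    simp only [Submodule.mem_iInf] at hq ⊢
    exact fun I => I.1.comp_mem_right s x p (hq I)

/-- The underlying collection of the quotient of an operad by an operadic ideal. -/
def COperad.quotientColl (P : COperad k C) (I : P.Ideal) : Collection k C where
  obj d := ModuleCat.of k (P.coll.val d.1.unop d.2 ⧸ I.carrier d.1.unop d.2)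
  map {d e} f := ModuleCat.ofHom
    (Submodule.mapQ (I.carrier d.1.unop d.2) (I.carrier e.1.unop e.2) (P.coll.map f).hom
      fun _ hp => I.act_mem f.1.unop f.2 hp)
  map_id d := by
    ext x
    simp
  map_comp f g := by
    ext x
    change Submodule.Quotient.mk ((P.coll.map (f ≫ g)).hom x) =
      Submodule.Quotient.mk ((P.coll.map g).hom ((P.coll.map f).hom x))
    rw [Functor.map_comp]
    rfl

/-- The class of an operation in the quotient operad. -/
def COperad.quotientMk (P : COperad k C) (I : P.Ideal) (a : Tup C) (x : C) :
    P.coll.val a x →ₗ[k] (P.quotientColl I).val a x :=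
  (I.carrier a x).mkQ

lemma COperad.quotientMk_surjective (P : COperad k C) (I : P.Ideal) (a : Tup C) (x : C) :
    Function.Surjective (P.quotientMk I a x) :=
  Submodule.Quotient.mk_surjective _

lemma COperad.act_quotientMk (P : COperad k C) (I : P.Ideal) {a b : Tup C} {x y : C}
    (f : b ⟶ a) (g : x ⟶ y) (p : P.coll.val a x) :
    (P.quotientColl I).act f g (P.quotientMk I a x p) = P.quotientMk I b y (P.coll.act f g p) :=
  rfl

/-- The composition of the quotient operad. -/
def COperad.quotientComp (P : COperad k C) (I : P.Ideal) {a : Tup C} {i : Fin a.len} {b : Tup C}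
    {y : C} {t : Tup C} (s : IsSplice a i b y t) (x : C) :
    (P.quotientColl I).val a x →ₗ[k] (P.quotientColl I).val b y →ₗ[k] (P.quotientColl I).val t x :=
  Submodule.liftQ (I.carrier a x)
    (LinearMap.mk₂ k
      (fun (p : P.coll.val a x) (q : P.coll.val b y ⧸ I.carrier b y) =>
        (Submodule.mapQ (I.carrier b y) (I.carrier t x) (P.comp s x p)
          (fun _ hq => I.comp_mem_right s x p hq) q : P.coll.val t x ⧸ I.carrier t x))
      (fun p p' q => by
        obtain ⟨q, rfl⟩ := Submodule.Quotient.mk_surjective _ q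
        simp
        rfl)
      (fun r p q => by
        obtain ⟨q, rfl⟩ := Submodule.Quotient.mk_surjective _ q
        simp
        rfl)
      (fun p q q' => map_add _ _ _)
      (fun r p q => map_smul _ _ _))
    (fun p hp => by
      refine LinearMap.ext fun q => ?_
      obtain ⟨q, rfl⟩ := Submodule.Quotient.mk_surjective _ q
      exact (Submodule.Quotient.mk_eq_zero _).mpr (I.comp_mem_left s x hp q))

lemma COperad.quotientComp_mk (P : COperad k C) (I : P.Ideal) {a : Tup C} {i : Fin a.len}
    {b : Tup C} {y : C} {t : Tup C} (s : IsSplice a i b y t) (x : C) (p : P.coll.val a x)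
    (q : P.coll.val b y) :
    P.quotientComp I s x (P.quotientMk I a x p) (P.quotientMk I b y q) =
      P.quotientMk I t x (P.comp s x p q) :=
  rfl

/-- The quotient of an operad by an operadic ideal. -/
def COperad.quotient (P : COperad k C) (I : P.Ideal) : COperad k C where
  coll := P.quotientColl I
  comp s x := P.quotientComp I s x
  comp_act_output {a i b y t} s x x' g p q := by
    obtain ⟨p, rfl⟩ := P.quotientMk_surjective I _ _ p
    obtain ⟨q, rfl⟩ := P.quotientMk_surjective I _ _ q
    simp only [P.act_quotientMk, P.quotientComp_mk, P.comp_act_output]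
  comp_act_input s f s' g x p q := by
    obtain ⟨p, rfl⟩ := P.quotientMk_surjective I _ _ p
    obtain ⟨q, rfl⟩ := P.quotientMk_surjective I _ _ q
    simp only [P.act_quotientMk, P.quotientComp_mk, P.comp_act_input s f s' g]
  assoc_seq s₁ s₂ s₃ s₄ x p q r := by
    obtain ⟨p, rfl⟩ := P.quotientMk_surjective I _ _ p
    obtain ⟨q, rfl⟩ := P.quotientMk_surjective I _ _ q
    obtain ⟨r, rfl⟩ := P.quotientMk_surjective I _ _ r
    simp only [P.quotientComp_mk, P.assoc_seq s₁ s₂ s₃ s₄]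
  assoc_par hij s₁ s₂ s₃ s₄ x p q r := by
    obtain ⟨p, rfl⟩ := P.quotientMk_surjective I _ _ p
    obtain ⟨q, rfl⟩ := P.quotientMk_surjective I _ _ q
    obtain ⟨r, rfl⟩ := P.quotientMk_surjective I _ _ r
    simp only [P.quotientComp_mk, P.assoc_par hij s₁ s₂ s₃ s₄]

end Operads

end HyperOp
namespace HyperOp

section Free

variable {k : Type u} [Field k] {C : Type u} [SmallCategory C]

/-! #### Free operads -/

/-- Formal expressions in the elements of `X`, the vector space operations, the action of the
morphisms of `(𝕊C)ᵒᵖ × C`, and the compositions of a `C`-operad. -/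
inductive FreePre (X : NSCollection k C) : Tup C → C → Type u
  | gen {n : ℕ} {c : Fin n → C} {x : C} (p : (X n).obj (fun i => op (c i), x)) : FreePre X ⟨n, c⟩ x
  | zero {a : Tup C} {x : C} : FreePre X a x
  | add {a : Tup C} {x : C} (p q : FreePre X a x) : FreePre X a x
  | smul {a : Tup C} {x : C} (r : k) (p : FreePre X a x) : FreePre X a x
  | act {a b : Tup C} {x y : C} (f : b ⟶ a) (g : x ⟶ y) (p : FreePre X a x) : FreePre X b y
  | comp {a : Tup C} {i : Fin a.len} {b : Tup C} {y : C} {t : Tup C} {x : C}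
      (s : IsSplice a i b y t) (p : FreePre X a x) (q : FreePre X b y) : FreePre X t x

namespace FreePre

/-- The congruence on formal expressions generated by the axioms of vector spaces, the axioms of a
`C`-operad, and the requirement that `gen` is a morphism of non-symmetric collections. -/
inductive Rel {X : NSCollection k C} : ∀ {a : Tup C} {x : C}, FreePre X a x → FreePre X a x → Prop
  -- equivalence relation
  | refl {a : Tup C} {x : C} (p : FreePre X a x) : Rel p p
  | symm {a : Tup C} {x : C} {p q : FreePre X a x} : Rel p q → Rel q p
  | trans {a : Tup C} {x : C} {p q r : FreePre X a x} : Rel p q → Rel q r → Rel p r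
  -- congruence
  | add_congr {a : Tup C} {x : C} {p p' q q' : FreePre X a x} :
      Rel p p' → Rel q q' → Rel (add p q) (add p' q')
  | smul_congr {a : Tup C} {x : C} (r : k) {p p' : FreePre X a x} :
      Rel p p' → Rel (smul r p) (smul r p')
  | act_congr {a b : Tup C} {x y : C} (f : b ⟶ a) (g : x ⟶ y) {p p' : FreePre X a x} :
      Rel p p' → Rel (act f g p) (act f g p')
  | comp_congr {a : Tup C} {i : Fin a.len} {b : Tup C} {y : C} {t : Tup C} {x : C}
      (s : IsSplice a i b y t) {p p' : FreePre X a x} {q q' : FreePre X b y} :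
      Rel p p' → Rel q q' → Rel (comp s p q) (comp s p' q')
  -- vector space axioms
  | add_assoc {a : Tup C} {x : C} (p q r : FreePre X a x) :
      Rel (add (add p q) r) (add p (add q r))
  | add_comm {a : Tup C} {x : C} (p q : FreePre X a x) : Rel (add p q) (add q p)
  | zero_add {a : Tup C} {x : C} (p : FreePre X a x) : Rel (add zero p) p
  | neg_add_cancel {a : Tup C} {x : C} (p : FreePre X a x) : Rel (add (smul (-1) p) p) zero
  | one_smul {a : Tup C} {x : C} (p : FreePre X a x) : Rel (smul 1 p) p
  | mul_smul {a : Tup C} {x : C} (r r' : k) (p : FreePre X a x) :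
      Rel (smul (r * r') p) (smul r (smul r' p))
  | smul_add {a : Tup C} {x : C} (r : k) (p q : FreePre X a x) :
      Rel (smul r (add p q)) (add (smul r p) (smul r q))
  | add_smul {a : Tup C} {x : C} (r r' : k) (p : FreePre X a x) :
      Rel (smul (r + r') p) (add (smul r p) (smul r' p))
  | zero_smul {a : Tup C} {x : C} (p : FreePre X a x) : Rel (smul 0 p) zero
  | smul_zero {a : Tup C} {x : C} (r : k) : Rel (smul r (zero : FreePre X a x)) zero
  -- `gen` is a morphism of non-symmetric collections
  | gen_add {n : ℕ} {c : Fin n → C} {x : C} (p q : (X n).obj (fun i => op (c i), x)) :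
      Rel (gen (p + q)) (add (gen p) (gen q))
  | gen_smul {n : ℕ} {c : Fin n → C} {x : C} (r : k) (p : (X n).obj (fun i => op (c i), x)) :
      Rel (gen (r • p)) (smul r (gen p))
  | gen_act {n : ℕ} {c c' : Fin n → C} {x y : C} (f : ∀ i, c' i ⟶ c i) (g : x ⟶ y)
      (p : (X n).obj (fun i => op (c i), x)) :
      Rel (act (b := ⟨n, c'⟩) (a := ⟨n, c⟩) ⟨Equiv.refl _, f⟩ g (gen p))
        (gen (((X n).map (Prod.mkHom (X₁ := fun i => op (c i)) (X₂ := fun i => op (c' i))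
          (fun i => (f i).op) g)).hom p))
  -- the action is functorial and linear
  | act_id {a : Tup C} {x : C} (p : FreePre X a x) : Rel (act (𝟙 a) (𝟙 x) p) p
  | act_act {a b c : Tup C} {x y z : C} (f : b ⟶ a) (f' : c ⟶ b) (g : x ⟶ y) (g' : y ⟶ z)
      (p : FreePre X a x) : Rel (act (f' ≫ f) (g ≫ g') p) (act f' g' (act f g p))
  | act_add {a b : Tup C} {x y : C} (f : b ⟶ a) (g : x ⟶ y) (p q : FreePre X a x) :
      Rel (act f g (add p q)) (add (act f g p) (act f g q))
  | act_smul {a b : Tup C} {x y : C} (f : b ⟶ a) (g : x ⟶ y) (r : k) (p : FreePre X a x) :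
      Rel (act f g (smul r p)) (smul r (act f g p))
  -- the composition is bilinear
  | comp_add_left {a : Tup C} {i : Fin a.len} {b : Tup C} {y : C} {t : Tup C} {x : C}
      (s : IsSplice a i b y t) (p p' : FreePre X a x) (q : FreePre X b y) :
      Rel (comp s (add p p') q) (add (comp s p q) (comp s p' q))
  | comp_smul_left {a : Tup C} {i : Fin a.len} {b : Tup C} {y : C} {t : Tup C} {x : C}
      (s : IsSplice a i b y t) (r : k) (p : FreePre X a x) (q : FreePre X b y) :
      Rel (comp s (smul r p) q) (smul r (comp s p q))
  | comp_add_right {a : Tup C} {i : Fin a.len} {b : Tup C} {y : C} {t : Tup C} {x : C}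
      (s : IsSplice a i b y t) (p : FreePre X a x) (q q' : FreePre X b y) :
      Rel (comp s p (add q q')) (add (comp s p q) (comp s p q'))
  | comp_smul_right {a : Tup C} {i : Fin a.len} {b : Tup C} {y : C} {t : Tup C} {x : C}
      (s : IsSplice a i b y t) (r : k) (p : FreePre X a x) (q : FreePre X b y) :
      Rel (comp s p (smul r q)) (smul r (comp s p q))
  -- the axioms of an operad
  | comp_act_output {a : Tup C} {i : Fin a.len} {b : Tup C} {y : C} {t : Tup C}
      (s : IsSplice a i b y t) {x x' : C} (g : x ⟶ x') (p : FreePre X a x) (q : FreePre X b y) :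
      Rel (comp s (act (𝟙 a) g p) q) (act (𝟙 t) g (comp s p q))
  | comp_act_input {a a' b b' t t' : Tup C} {i : Fin a.len} {y y' : C} (s : IsSplice a i b y t)
      (f : a ⟶ a') (s' : IsSplice a' (Tup.Hom.perm f i) b' y' t') (g : b ⟶ b') (x : C)
      (p : FreePre X a' x) (q : FreePre X b' y) :
      Rel (comp s (act f (𝟙 x) p) (act g (𝟙 y) q))
        (act (spliceHom s f s' g) (𝟙 x) (comp s' p (act (𝟙 b') (midHom s f s') q)))
  | assoc_seq {a b c t u v : Tup C} {i : Fin a.len} {j : Fin b.len} {y z : C}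
      (s₁ : IsSplice a i b y t) (s₂ : IsSplice t (place s₁.len_eq i (Sum.inr j)) c z u)
      (s₃ : IsSplice b j c z v) (s₄ : IsSplice a i v y u) (x : C)
      (p : FreePre X a x) (q : FreePre X b y) (r : FreePre X c z) :
      Rel (comp s₂ (comp s₁ p q) r) (comp s₄ p (comp s₃ q r))
  | assoc_par {a b c t u v : Tup C} {i j : Fin a.len} {y z : C} (hij : i ≠ j)
      (s₁ : IsSplice a i b y t)
      (s₂ : IsSplice t (place s₁.len_eq i (Sum.inl ⟨j, hij.symm⟩)) c z u)
      (s₃ : IsSplice a j c z v) (s₄ : IsSplice v (place s₃.len_eq j (Sum.inl ⟨i, hij⟩)) b y u)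
      (x : C) (p : FreePre X a x) (q : FreePre X b y) (r : FreePre X c z) :
      Rel (comp s₂ (comp s₁ p q) r) (comp s₄ (comp s₃ p r) q)

/-- `Rel` as a setoid. -/
def setoid (X : NSCollection k C) (a : Tup C) (x : C) : Setoid (FreePre X a x) :=
  ⟨Rel, Rel.refl, Rel.symm, Rel.trans⟩

end FreePre

variable (X : NSCollection k C)

/-- The operations of the free operad. -/
def FreeVal (a : Tup C) (x : C) : Type u := Quotient (FreePre.setoid X a x)

namespace FreeVal

variable {X} {a b : Tup C} {x y : C}

/-- The class of a formal expression. -/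
def mk (p : FreePre X a x) : FreeVal X a x := Quotient.mk (FreePre.setoid X a x) p

lemma mk_surjective : Function.Surjective (mk : FreePre X a x → FreeVal X a x) :=
  Quotient.exists_rep

lemma sound {p q : FreePre X a x} (h : FreePre.Rel p q) : mk p = mk q :=
  Quotient.sound (s := FreePre.setoid X a x) h

instance : Zero (FreeVal X a x) := ⟨mk FreePre.zero⟩

instance : Add (FreeVal X a x) :=
  ⟨Quotient.map₂ FreePre.add fun _ _ h _ _ h' => FreePre.Rel.add_congr h h'⟩

instance : Neg (FreeVal X a x) :=
  ⟨Quotient.map (FreePre.smul (-1)) fun _ _ h => FreePre.Rel.smul_congr _ h⟩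

instance : AddCommGroup (FreeVal X a x) where
  add_assoc := by
    rintro ⟨p⟩ ⟨q⟩ ⟨r⟩
    exact sound (.add_assoc p q r)
  add_comm := by
    rintro ⟨p⟩ ⟨q⟩
    exact sound (.add_comm p q)
  zero_add := by
    rintro ⟨p⟩
    exact sound (.zero_add p)
  add_zero := by
    rintro ⟨p⟩
    exact sound (.trans (.add_comm _ _) (.zero_add p))
  neg_add_cancel := by
    rintro ⟨p⟩
    exact sound (.neg_add_cancel p)
  nsmul := nsmulRec
  zsmul := zsmulRec

instance : Module k (FreeVal X a x) where
  smul r := Quotient.map (FreePre.smul r) fun _ _ h => FreePre.Rel.smul_congr r h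
  one_smul := by
    rintro ⟨p⟩
    exact sound (.one_smul p)
  mul_smul := by
    rintro r r' ⟨p⟩
    exact sound (.mul_smul r r' p)
  smul_zero r := sound (.smul_zero r)
  smul_add := by
    rintro r ⟨p⟩ ⟨q⟩
    exact sound (.smul_add r p q)
  add_smul := by
    rintro r r' ⟨p⟩
    exact sound (.add_smul r r' p)
  zero_smul := by
    rintro ⟨p⟩
    exact sound (.zero_smul p)

/-- The action on the operations of the free operad. -/
def act (f : b ⟶ a) (g : x ⟶ y) : FreeVal X a x →ₗ[k] FreeVal X b y where
  toFun := Quotient.map (FreePre.act f g) fun _ _ h => FreePre.Rel.act_congr f g h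
  map_add' := by
    rintro ⟨p⟩ ⟨q⟩
    exact sound (.act_add f g p q)
  map_smul' := by
    rintro r ⟨p⟩
    exact sound (.act_smul f g r p)

/-- The composition of the free operad. -/
def comp {i : Fin a.len} {t : Tup C} (s : IsSplice a i b y t) (x : C) :
    FreeVal X a x →ₗ[k] FreeVal X b y →ₗ[k] FreeVal X t x :=
  LinearMap.mk₂ k
    (Quotient.map₂ (FreePre.comp s) fun _ _ h _ _ h' => FreePre.Rel.comp_congr s h h')
    (by
      rintro ⟨p⟩ ⟨p'⟩ ⟨q⟩
      exact sound (.comp_add_left s p p' q))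
    (by
      rintro r ⟨p⟩ ⟨q⟩
      exact sound (.comp_smul_left s r p q))
    (by
      rintro ⟨p⟩ ⟨q⟩ ⟨q'⟩
      exact sound (.comp_add_right s p q q'))
    (by
      rintro r ⟨p⟩ ⟨q⟩
      exact sound (.comp_smul_right s r p q))

end FreeVal

/-- The free `C`-operad on a non-symmetric `C`-collection. -/
def FreeOperad : COperad k C where
  coll :=
    { obj := fun d => ModuleCat.of k (FreeVal X d.1.unop d.2)
      map := fun f => ModuleCat.ofHom (FreeVal.act f.1.unop f.2)
      map_id := fun d => by
        ext ⟨p⟩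
        exact FreeVal.sound (.act_id p)
      map_comp := fun f g => by
        ext ⟨p⟩
        exact FreeVal.sound (.act_act f.1.unop g.1.unop f.2 g.2 p) }
  comp s x := FreeVal.comp s x
  comp_act_output s x x' g := by
    rintro ⟨p⟩ ⟨q⟩
    exact FreeVal.sound (.comp_act_output s g p q)
  comp_act_input s f s' g x := by
    rintro ⟨p⟩ ⟨q⟩
    exact FreeVal.sound (.comp_act_input s f s' g x p q)
  assoc_seq s₁ s₂ s₃ s₄ x := by
    rintro ⟨p⟩ ⟨q⟩ ⟨r⟩
    exact FreeVal.sound (.assoc_seq s₁ s₂ s₃ s₄ x p q r)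
  assoc_par hij s₁ s₂ s₃ s₄ x := by
    rintro ⟨p⟩ ⟨q⟩ ⟨r⟩
    exact FreeVal.sound (.assoc_par hij s₁ s₂ s₃ s₄ x p q r)

namespace FreeOperad

/-- The generators of the free operad. -/
def gen {n : ℕ} (c : Fin n → C) (x : C) :
    (X n).obj (fun i => op (c i), x) →ₗ[k] (FreeOperad X).coll.val ⟨n, c⟩ x where
  toFun p := FreeVal.mk (FreePre.gen p)
  map_add' p q := FreeVal.sound (.gen_add p q)
  map_smul' r p := FreeVal.sound (.gen_smul r p)

/-- The homogeneous operations of weight `w`: the linear combinations of iterated compositions of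
`w` generators. -/
inductive IsWeight : ℕ → ∀ {a : Tup C} {x : C}, (FreeOperad X).coll.val a x → Prop
  | gen {n : ℕ} {c : Fin n → C} {x : C} (p : (X n).obj (fun i => op (c i), x)) :
      IsWeight 1 (gen X c x p)
  | act {w : ℕ} {a b : Tup C} {x y : C} (f : b ⟶ a) (g : x ⟶ y)
      {p : (FreeOperad X).coll.val a x} : IsWeight w p → IsWeight w ((FreeOperad X).coll.act f g p)
  | comp {w w' : ℕ} {a : Tup C} {i : Fin a.len} {b : Tup C} {y : C} {t : Tup C} {x : C}
      (s : IsSplice a i b y t) {p : (FreeOperad X).coll.val a x}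
      {q : (FreeOperad X).coll.val b y} :
      IsWeight w p → IsWeight w' q → IsWeight (w + w') ((FreeOperad X).comp s x p q)
  | zero {w : ℕ} {a : Tup C} {x : C} : IsWeight w (0 : (FreeOperad X).coll.val a x)
  | add {w : ℕ} {a : Tup C} {x : C} {p q : (FreeOperad X).coll.val a x} :
      IsWeight w p → IsWeight w q → IsWeight w (p + q)
  | smul {w : ℕ} {a : Tup C} {x : C} (r : k) {p : (FreeOperad X).coll.val a x} :
      IsWeight w p → IsWeight w (r • p)

end FreeOperad

/-- A `C`-operad is binary quadratic if it is of the form `F(X)/(A)`, where `Xₙ = 0` for `n ≠ 2`,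
and `A` consists of operations of weight two. -/
def COperad.IsBinaryQuadratic (P : COperad k C) : Prop :=
  ∃ (X : NSCollection k C) (A : ∀ (a : Tup C) (x : C), Set ((FreeOperad X).coll.val a x)),
    (∀ n, n ≠ 2 → ∀ d, Subsingleton ((X n).obj d)) ∧
    (∀ a x, ∀ p ∈ A a x, FreeOperad.IsWeight X 2 p) ∧
    Nonempty (P ≅ (FreeOperad X).quotient ((FreeOperad X).idealSpan A))

end Free

/-! #### Endomorphism operads and algebras -/

section Algebras

variable {k : Type u} [Field k] {C : Type u} [SmallCategory C] (A : C ⥤ ModuleCat.{u} k)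

/-- `A(f)` as a linear map. -/
def mapLin {x y : C} (f : x ⟶ y) : A.obj x →ₗ[k] A.obj y := (A.map f).hom

@[simp] lemma mapLin_id (x : C) (v : A.obj x) : mapLin A (𝟙 x) v = v := by simp [mapLin]

@[simp] lemma mapLin_mapLin {x y z : C} (f : x ⟶ y) (g : y ⟶ z) (v : A.obj x) :
    mapLin A g (mapLin A f v) = mapLin A (f ≫ g) v := by simp [mapLin]

/-- A morphism `f : b ⟶ a` of `𝕊C` maps the tuples in `∏ A(bᵢ)` to the tuples in `∏ A(aᵢ)`. -/
def pushTuple {a b : Tup C} (f : b ⟶ a) (v : ∀ j, A.obj (b.col j)) (j : Fin a.len) :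
    A.obj (a.col j) :=
  mapLin A (Tup.Hom.map f ((Tup.Hom.perm f).symm j) ≫ eqToHom (by rw [Equiv.apply_symm_apply]))
    (v ((Tup.Hom.perm f).symm j))

lemma mapLin_congr_index {a : Tup C} (v : ∀ j, A.obj (a.col j)) {j j' : Fin a.len} (h : j = j')
    {x : C} (f : a.col j ⟶ x) (f' : a.col j' ⟶ x) (hf : f = eqToHom (by rw [h]) ≫ f') :
    mapLin A f (v j) = mapLin A f' (v j') := by
  subst h
  simp [hf]

lemma pushTuple_perm {a b : Tup C} (f : b ⟶ a) (v : ∀ j, A.obj (b.col j)) (i : Fin b.len) :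
    pushTuple A f v (Tup.Hom.perm f i) = mapLin A (Tup.Hom.map f i) (v i) := by
  unfold pushTuple
  apply mapLin_congr_index A v (Equiv.symm_apply_apply _ _)
  have : ∀ (j : Fin b.len) (h : j = i), Tup.Hom.map f j ≫ eqToHom (by rw [h]) =
      eqToHom (by rw [h]) ≫ Tup.Hom.map f i := by
    rintro j rfl
    simp
  exact this _ (Equiv.symm_apply_apply _ _)

lemma pushTuple_id {a : Tup C} (v : ∀ j, A.obj (a.col j)) : pushTuple A (𝟙 a) v = v := by
  funext j
  exact (pushTuple_perm A (𝟙 a) v j).trans (mapLin_id A _ _)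

lemma pushTuple_comp {a b c : Tup C} (f : b ⟶ a) (g : c ⟶ b) (v : ∀ j, A.obj (c.col j)) :
    pushTuple A (g ≫ f) v = pushTuple A f (pushTuple A g v) := by
  funext j
  obtain ⟨j, rfl⟩ := (Tup.Hom.perm f).surjective j
  obtain ⟨j, rfl⟩ := (Tup.Hom.perm g).surjective j
  rw [pushTuple_perm, pushTuple_perm]
  exact (pushTuple_perm A (g ≫ f) v j).trans (mapLin_mapLin A _ _ _).symm

lemma pushTuple_update {a b : Tup C} (f : b ⟶ a) [DecidableEq (Fin b.len)]
    (v : ∀ j, A.obj (b.col j)) (i : Fin b.len) (w : A.obj (b.col i)) :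
    pushTuple A f (Function.update v i w) =
      Function.update (pushTuple A f v) (Tup.Hom.perm f i) (mapLin A (Tup.Hom.map f i) w) := by
  funext j
  obtain ⟨j, rfl⟩ := (Tup.Hom.perm f).surjective j
  rw [pushTuple_perm]
  by_cases h : j = i
  · subst h
    simp
  · rw [Function.update_of_ne h, Function.update_of_ne (by simpa using h), pushTuple_perm]

/-- The underlying collection of the endomorphism operad of `A`: its value on `(c₁ … cₙ; c)` is the
space of multilinear maps `A(c₁) × ⋯ × A(cₙ) ⟶ A(c)`, i.e. `Hom(A(c₁) ⊗ ⋯ ⊗ A(cₙ), A(c))`. -/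
def endColl : Collection k C where
  obj d := ModuleCat.of k (MultilinearMap k (fun j => A.obj (d.1.unop.col j)) (A.obj d.2))
  map {d e} f := ModuleCat.ofHom
    { toFun := fun (φ : MultilinearMap k (fun j => A.obj (d.1.unop.col j)) (A.obj d.2)) =>
        ({ toFun := fun v => mapLin A f.2 (φ (pushTuple A f.1.unop v))
           map_update_add' := fun v i w w' => by
            simp only [pushTuple_update, map_add, MultilinearMap.map_update_add]
           map_update_smul' := fun v i r w => by
            simp only [pushTuple_update, map_smul, MultilinearMap.map_update_smul] } :
          MultilinearMap k (fun j => A.obj (e.1.unop.col j)) (A.obj e.2))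
      map_add' := fun φ ψ => by
        ext v
        simp
      map_smul' := fun r φ => by
        ext v
        simp }
  map_id d := by
    ext φ v
    change mapLin A (𝟙 d.2) (φ (pushTuple A (𝟙 d.1.unop) v)) = φ v
    rw [pushTuple_id, mapLin_id]
  map_comp {d e h} f g := by
    ext φ v
    change mapLin A (f.2 ≫ g.2) (φ (pushTuple A (g.1.unop ≫ f.1.unop) v)) =
      mapLin A g.2 (mapLin A f.2 (φ (pushTuple A f.1.unop (pushTuple A g.1.unop v))))
    rw [pushTuple_comp, mapLin_mapLin]

/-- The operations of the endomorphism operad, as multilinear maps. -/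
abbrev EndVal (a : Tup C) (x : C) : Type u :=
  MultilinearMap k (fun j => A.obj (a.col j)) (A.obj x)

section

variable {a : Tup C} {i : Fin a.len} {b : Tup C} {y : C} {t : Tup C} (s : IsSplice a i b y t)

/-- The entries at the inserted places of a tuple in `∏ A(tⱼ)`, where `t` is the list `a` with the
`i`-th entry replaced by the list `b`. -/
noncomputable def innerTuple (v : ∀ j, A.obj (t.col j)) (q : Fin b.len) : A.obj (b.col q) :=
  mapLin A (eqToHom (s.col_inner q)) (v (place s.len_eq i (Sum.inr q)))

/-- The tuple in `∏ A(aⱼ)` with the `i`-th entry `w` and the remaining entries from `v`. -/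
noncomputable def outerTuple (v : ∀ j, A.obj (t.col j)) (w : A.obj y) (j : Fin a.len) :
    A.obj (a.col j) :=
  if h : j = i then mapLin A (eqToHom (by rw [h, s.col_eq])) w
  else mapLin A (eqToHom (s.col_outer ⟨j, h⟩)) (v (place s.len_eq i (Sum.inl ⟨j, h⟩)))

lemma outerTuple_self (v : ∀ j, A.obj (t.col j)) (w : A.obj y) :
    outerTuple A s v w i = mapLin A (eqToHom s.col_eq.symm) w := by simp [outerTuple]

lemma outerTuple_ne (v : ∀ j, A.obj (t.col j)) (w : A.obj y) {j : Fin a.len} (h : j ≠ i) :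
    outerTuple A s v w j = mapLin A (eqToHom (s.col_outer ⟨j, h⟩))
      (v (place s.len_eq i (Sum.inl ⟨j, h⟩))) := by simp [outerTuple, h]

lemma outerTuple_eq_update (v : ∀ j, A.obj (t.col j)) (w : A.obj y) :
    outerTuple A s v w =
      Function.update (outerTuple A s v 0) i (mapLin A (eqToHom s.col_eq.symm) w) := by
  funext j
  by_cases h : j = i
  · subst h
    rw [outerTuple_self, Function.update_self]
  · rw [Function.update_of_ne h, outerTuple_ne A s v w h, outerTuple_ne A s v 0 h]

lemma innerTuple_update_inl [DecidableEq (Fin t.len)] (v : ∀ j, A.obj (t.col j))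
    (j : {j : Fin a.len // j ≠ i}) (w : A.obj (t.col (place s.len_eq i (Sum.inl j)))) :
    innerTuple A s (Function.update v (place s.len_eq i (Sum.inl j)) w) = innerTuple A s v := by
  funext q
  simp [innerTuple]

lemma innerTuple_update_inr [DecidableEq (Fin t.len)] (v : ∀ j, A.obj (t.col j)) (q : Fin b.len)
    (w : A.obj (t.col (place s.len_eq i (Sum.inr q)))) :
    innerTuple A s (Function.update v (place s.len_eq i (Sum.inr q)) w) =
      Function.update (innerTuple A s v) q (mapLin A (eqToHom (s.col_inner q)) w) := by
  funext q'
  by_cases h : q' = q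
  · subst h
    simp [innerTuple]
  · rw [Function.update_of_ne h]
    unfold innerTuple
    rw [Function.update_of_ne (by simpa using h)]

lemma outerTuple_update_inl [DecidableEq (Fin t.len)] (v : ∀ j, A.obj (t.col j))
    (j : {j : Fin a.len // j ≠ i}) (w : A.obj (t.col (place s.len_eq i (Sum.inl j))))
    (u : A.obj y) :
    outerTuple A s (Function.update v (place s.len_eq i (Sum.inl j)) w) u =
      Function.update (outerTuple A s v u) j.1
        (mapLin A (eqToHom (s.col_outer j)) w) := by
  funext j'
  by_cases h : j' = i
  · subst h
    rw [outerTuple_self, Function.update_of_ne j.2.symm, outerTuple_self]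
  · rw [outerTuple_ne A s _ u h]
    by_cases h' : j' = j.1
    · subst h'
      simp
    · rw [Function.update_of_ne h', outerTuple_ne A s v u h, Function.update_of_ne]
      simpa [Subtype.ext_iff] using h'

lemma outerTuple_update_inr [DecidableEq (Fin t.len)] (v : ∀ j, A.obj (t.col j)) (q : Fin b.len)
    (w : A.obj (t.col (place s.len_eq i (Sum.inr q)))) (u : A.obj y) :
    outerTuple A s (Function.update v (place s.len_eq i (Sum.inr q)) w) u =
      outerTuple A s v u := by
  funext j'
  by_cases h : j' = i
  · subst h
    rw [outerTuple_self, outerTuple_self]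
  · rw [outerTuple_ne A s _ u h, outerTuple_ne A s _ u h, Function.update_of_ne (by simp)]

/-- The composition `φ ∘ᵢ ψ = φ(1 ⊗ ⋯ ⊗ ψ ⊗ ⋯ ⊗ 1)` of the endomorphism operad. -/
noncomputable def endCompAux {x : C} (φ : EndVal A a x) (ψ : EndVal A b y) : EndVal A t x where
  toFun v := φ (outerTuple A s v (ψ (innerTuple A s v)))
  map_update_add' v l w w' := by
    obtain ⟨z | z, rfl⟩ := (place s.len_eq i).surjective l
    · simp only [innerTuple_update_inl, outerTuple_update_inl, map_add,
        MultilinearMap.map_update_add]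
    · simp only [innerTuple_update_inr, outerTuple_update_inr, map_add,
        MultilinearMap.map_update_add]
      rw [outerTuple_eq_update, map_add, MultilinearMap.map_update_add, ← outerTuple_eq_update,
        ← outerTuple_eq_update]
  map_update_smul' v l r w := by
    obtain ⟨z | z, rfl⟩ := (place s.len_eq i).surjective l
    · simp only [innerTuple_update_inl, outerTuple_update_inl, map_smul,
        MultilinearMap.map_update_smul]
    · simp only [innerTuple_update_inr, outerTuple_update_inr, map_smul,
        MultilinearMap.map_update_smul]
      rw [outerTuple_eq_update, map_smul, MultilinearMap.map_update_smul, ← outerTuple_eq_update]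

/-- `endCompAux` as a bilinear map. -/
noncomputable def endComp (x : C) : EndVal A a x →ₗ[k] EndVal A b y →ₗ[k] EndVal A t x :=
  LinearMap.mk₂ k (endCompAux A s)
    (fun φ φ' ψ => by
      ext v
      simp [endCompAux])
    (fun r φ ψ => by
      ext v
      simp [endCompAux])
    (fun φ ψ ψ' => by
      ext v
      simp only [endCompAux, _root_.add_apply, MultilinearMap.coe_mk]
      rw [outerTuple_eq_update, map_add, MultilinearMap.map_update_add, ← outerTuple_eq_update,
        ← outerTuple_eq_update])
    (fun r φ ψ => by
      ext v
      simp only [endCompAux, _root_.smul_apply, MultilinearMap.coe_mk]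
      rw [outerTuple_eq_update, map_smul, MultilinearMap.map_update_smul, ← outerTuple_eq_update])

lemma endComp_apply {x : C} (φ : EndVal A a x) (ψ : EndVal A b y) (v : ∀ j, A.obj (t.col j)) :
    endComp A s x φ ψ v = φ (outerTuple A s v (ψ (innerTuple A s v))) := rfl

end

lemma endAct_apply {a b : Tup C} {x y : C} (f : b ⟶ a) (g : x ⟶ y) (φ : EndVal A a x)
    (v : ∀ j, A.obj (b.col j)) :
    (show EndVal A b y from (endColl A).act f g φ) v = mapLin A g (φ (pushTuple A f v)) := rfl

lemma spliceHom_map_place {a a' b b' t t' : Tup C} {y y' : C} {i : Fin a.len}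
    (s : IsSplice a i b y t) (f : a ⟶ a') (s' : IsSplice a' (Tup.Hom.perm f i) b' y' t')
    (g : b ⟶ b') (v : ∀ j, A.obj (t.col j)) (z) :
    pushTuple A (spliceHom s f s' g) v (place s'.len_eq (Tup.Hom.perm f i) (spliceSum f g z)) =
      mapLin A (eqToHom (s.col_place z) ≫ spliceSumHom f g z ≫ eqToHom (s'.col_place _).symm)
        (v (place s.len_eq i z)) := by
  have hp : Tup.Hom.perm (spliceHom s f s' g) (place s.len_eq i z) =
      place s'.len_eq (Tup.Hom.perm f i) (spliceSum f g z) := by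
    simp [spliceHom]
  unfold pushTuple
  have hz : ∀ l (hl : l = place s.len_eq i z)
      (hl' : t'.col (Tup.Hom.perm (spliceHom s f s' g) l) =
        t'.col (place s'.len_eq (Tup.Hom.perm f i) (spliceSum f g z))),
      Tup.Hom.map (spliceHom s f s' g) l ≫ eqToHom hl' =
      eqToHom (by rw [hl]) ≫ eqToHom (s.col_place z) ≫ spliceSumHom f g z ≫
        eqToHom (s'.col_place _).symm := by
    rintro l rfl hl'
    simp only [spliceHom, eqToHom_refl, Category.id_comp, Category.assoc]
    have : ∀ z' (h : z' = z) (m : C) h1 (h2 : _ = m) (h3 : m = _),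
        eqToHom h1 ≫ spliceSumHom f g z' ≫ eqToHom h2 ≫ eqToHom h3 =
        eqToHom (s.col_place z) ≫ spliceSumHom f g z ≫ eqToHom (s'.col_place _).symm := by
      rintro z' rfl m h1 h2 h3
      rw [eqToHom_trans]
    exact this _ (Equiv.symm_apply_apply _ _) _ _ _ _
  exact mapLin_congr_index A v (by rw [Equiv.symm_apply_eq, hp]) _ _
    (hz _ (by rw [Equiv.symm_apply_eq, hp]) _)

lemma spliceHom_map_outer {a a' b b' t t' : Tup C} {y y' : C} {i : Fin a.len}
    (s : IsSplice a i b y t) (f : a ⟶ a') (s' : IsSplice a' (Tup.Hom.perm f i) b' y' t')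
    (g : b ⟶ b') (v : ∀ j, A.obj (t.col j)) (j : Fin a.len) (h : j ≠ i)
    (h' : Tup.Hom.perm f j ≠ Tup.Hom.perm f i) :
    pushTuple A (spliceHom s f s' g) v
        (place s'.len_eq (Tup.Hom.perm f i) (Sum.inl ⟨Tup.Hom.perm f j, h'⟩)) =
      mapLin A (eqToHom (s.col_outer ⟨j, h⟩) ≫ Tup.Hom.map f j ≫
        eqToHom (s'.col_outer ⟨Tup.Hom.perm f j, h'⟩).symm)
        (v (place s.len_eq i (Sum.inl ⟨j, h⟩))) :=
  spliceHom_map_place A s f s' g v (Sum.inl ⟨j, h⟩)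

lemma spliceHom_map_inner {a a' b b' t t' : Tup C} {y y' : C} {i : Fin a.len}
    (s : IsSplice a i b y t) (f : a ⟶ a') (s' : IsSplice a' (Tup.Hom.perm f i) b' y' t')
    (g : b ⟶ b') (v : ∀ j, A.obj (t.col j)) (q : Fin b.len) :
    pushTuple A (spliceHom s f s' g) v
        (place s'.len_eq (Tup.Hom.perm f i) (Sum.inr (Tup.Hom.perm g q))) =
      mapLin A (eqToHom (s.col_inner q) ≫ Tup.Hom.map g q ≫
        eqToHom (s'.col_inner (Tup.Hom.perm g q)).symm)
        (v (place s.len_eq i (Sum.inr q))) :=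
  spliceHom_map_place A s f s' g v (Sum.inr q)

section Assoc

variable {a b c t u w : Tup C} {y z : C}

lemma inner_seq {i : Fin a.len} {j : Fin b.len} (s₁ : IsSplice a i b y t)
    (s₂ : IsSplice t (place s₁.len_eq i (Sum.inr j)) c z u)
    (s₃ : IsSplice b j c z w) (s₄ : IsSplice a i w y u) (v : ∀ j, A.obj (u.col j)) :
    innerTuple A s₂ v = innerTuple A s₃ (innerTuple A s₄ v) := by
  funext l
  unfold innerTuple
  rw [mapLin_mapLin]
  refine mapLin_congr_index A v (Fin.ext ?_) _ _ (by simp)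
  simp only [place_inr_val]
  omega

lemma inner_outer_seq {i : Fin a.len} {j : Fin b.len} (s₁ : IsSplice a i b y t)
    (s₂ : IsSplice t (place s₁.len_eq i (Sum.inr j)) c z u)
    (s₃ : IsSplice b j c z w) (s₄ : IsSplice a i w y u) (v : ∀ j, A.obj (u.col j))
    (ρ : A.obj z) :
    innerTuple A s₁ (outerTuple A s₂ v ρ) = outerTuple A s₃ (innerTuple A s₄ v) ρ := by
  funext l
  by_cases h : l = j
  · subst h
    rw [outerTuple_self]
    unfold innerTuple
    rw [outerTuple_self, mapLin_mapLin]
    simp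
  · have h' : place s₁.len_eq i (Sum.inr l) ≠ place s₁.len_eq i (Sum.inr j) := by simpa using h
    rw [outerTuple_ne A s₃ _ _ h]
    unfold innerTuple
    rw [outerTuple_ne A s₂ _ _ h', mapLin_mapLin, mapLin_mapLin]
    refine mapLin_congr_index A v (Fin.ext ?_) _ _ (by simp)
    have := Fin.val_ne_of_ne h
    have := s₁.len_eq
    have := s₃.len_eq
    simp only [place_inr_val, place_inl_val, Nat.add_lt_add_iff_left]
    split_ifs <;> omega

lemma outer_outer_seq {i : Fin a.len} {j : Fin b.len} (s₁ : IsSplice a i b y t)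
    (s₂ : IsSplice t (place s₁.len_eq i (Sum.inr j)) c z u)
    (s₃ : IsSplice b j c z w) (s₄ : IsSplice a i w y u) (v : ∀ j, A.obj (u.col j))
    (ρ : A.obj z) (κ : A.obj y) :
    outerTuple A s₁ (outerTuple A s₂ v ρ) κ = outerTuple A s₄ v κ := by
  funext l
  by_cases h : l = i
  · subst h
    rw [outerTuple_self, outerTuple_self]
  · have h' : place s₁.len_eq i (Sum.inl ⟨l, h⟩) ≠ place s₁.len_eq i (Sum.inr j) := by simp
    rw [outerTuple_ne A s₁ _ _ h, outerTuple_ne A s₄ _ _ h, outerTuple_ne A s₂ _ _ h',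
      mapLin_mapLin]
    refine mapLin_congr_index A v (Fin.ext ?_) _ _ (by simp)
    have := Fin.val_ne_of_ne h
    have := s₁.len_eq
    have := s₃.len_eq
    have := j.2
    simp only [place_inr_val, place_inl_val]
    split_ifs <;> omega

lemma inner_par {i j : Fin a.len} (hij : i ≠ j) (s₁ : IsSplice a i b y t)
    (s₂ : IsSplice t (place s₁.len_eq i (Sum.inl ⟨j, hij.symm⟩)) c z u)
    (s₃ : IsSplice a j c z w) (s₄ : IsSplice w (place s₃.len_eq j (Sum.inl ⟨i, hij⟩)) b y u)
    (v : ∀ j, A.obj (u.col j)) (ρ : A.obj z) :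
    innerTuple A s₁ (outerTuple A s₂ v ρ) = innerTuple A s₄ v := by
  funext l
  have h' : place s₁.len_eq i (Sum.inr l) ≠ place s₁.len_eq i (Sum.inl ⟨j, hij.symm⟩) := by simp
  unfold innerTuple
  rw [outerTuple_ne A s₂ _ _ h', mapLin_mapLin]
  refine mapLin_congr_index A v (Fin.ext ?_) _ _ (by simp)
  have := Fin.val_ne_of_ne hij
  have := s₁.len_eq
  have := s₃.len_eq
  have := l.2
  simp only [place_inr_val, place_inl_val]
  split_ifs <;> omega

lemma outer_par {i j : Fin a.len} (hij : i ≠ j) (s₁ : IsSplice a i b y t)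
    (s₂ : IsSplice t (place s₁.len_eq i (Sum.inl ⟨j, hij.symm⟩)) c z u)
    (s₃ : IsSplice a j c z w) (s₄ : IsSplice w (place s₃.len_eq j (Sum.inl ⟨i, hij⟩)) b y u)
    (v : ∀ j, A.obj (u.col j)) (ρ : A.obj z) (κ : A.obj y) :
    outerTuple A s₁ (outerTuple A s₂ v ρ) κ = outerTuple A s₃ (outerTuple A s₄ v κ) ρ := by
  funext l
  by_cases h : l = i
  · subst h
    rw [outerTuple_self, outerTuple_ne A s₃ _ _ hij, outerTuple_self, mapLin_mapLin]
    simp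
  · by_cases h' : l = j
    · subst h'
      rw [outerTuple_self, outerTuple_ne A s₁ _ _ hij.symm, outerTuple_self, mapLin_mapLin]
      simp
    · have h₁ : place s₁.len_eq i (Sum.inl ⟨l, h⟩) ≠
          place s₁.len_eq i (Sum.inl ⟨j, hij.symm⟩) := by simpa using h'
      have h₃ : place s₃.len_eq j (Sum.inl ⟨l, h'⟩) ≠
          place s₃.len_eq j (Sum.inl ⟨i, hij⟩) := by simpa using h
      rw [outerTuple_ne A s₁ _ _ h, outerTuple_ne A s₃ _ _ h', outerTuple_ne A s₂ _ _ h₁,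
        outerTuple_ne A s₄ _ _ h₃, mapLin_mapLin, mapLin_mapLin]
      refine mapLin_congr_index A v (Fin.ext ?_) _ _ (by simp)
      have := Fin.val_ne_of_ne hij
      have := Fin.val_ne_of_ne h
      have := Fin.val_ne_of_ne h'
      have := s₁.len_eq
      have := s₃.len_eq
      simp only [place_inl_val]
      split_ifs <;> omega

end Assoc

/-- The endomorphism operad of a functor `A : C ⥤ Vect`. -/
noncomputable def endOperad : COperad k C where
  coll := endColl A
  comp s x := endComp A s x
  comp_act_output {a i b y t} s {x x'} g (p : EndVal A a x) (q : EndVal A b y) := by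
    refine MultilinearMap.ext fun v => ?_
    change mapLin A g (p (pushTuple A (𝟙 a) _)) =
      mapLin A g (p (outerTuple A s (pushTuple A (𝟙 t) v)
        (q (innerTuple A s (pushTuple A (𝟙 t) v)))))
    rw [pushTuple_id, pushTuple_id]
  comp_act_input {a a' b b' t t' i y y'} s f s' g x (p : EndVal A a' x) (q : EndVal A b' y) := by
    refine MultilinearMap.ext fun v => ?_
    change mapLin A (𝟙 x) (p (pushTuple A f (outerTuple A s v
        (mapLin A (𝟙 y) (q (pushTuple A g (innerTuple A s v))))))) =
      mapLin A (𝟙 x) (p (outerTuple A s' (pushTuple A (spliceHom s f s' g) v)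
        (mapLin A (midHom s f s') (q
          (pushTuple A (𝟙 b') (innerTuple A s' (pushTuple A (spliceHom s f s' g) v)))))))
    rw [pushTuple_id, mapLin_id, mapLin_id, mapLin_id]
    have hin : innerTuple A s' (pushTuple A (spliceHom s f s' g) v) =
        pushTuple A g (innerTuple A s v) := by
      funext q
      obtain ⟨q, rfl⟩ := (Tup.Hom.perm g).surjective q
      rw [pushTuple_perm]
      unfold innerTuple
      rw [spliceHom_map_inner, mapLin_mapLin, mapLin_mapLin]
      simp
    rw [hin]
    congr 1
    funext j
    obtain ⟨j, rfl⟩ := (Tup.Hom.perm f).surjective j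
    rw [pushTuple_perm]
    by_cases h : j = i
    · subst h
      rw [outerTuple_self, outerTuple_self]
      simp [midHom]
    · have h' : Tup.Hom.perm f j ≠ Tup.Hom.perm f i := by simpa using h
      rw [outerTuple_ne A s _ _ h, outerTuple_ne A s' _ _ h']
      rw [spliceHom_map_outer A s f s' g v j h h', mapLin_mapLin, mapLin_mapLin]
      simp
  assoc_seq {a b c t u w i j y z} s₁ s₂ s₃ s₄ x (p : EndVal A a x) (q : EndVal A b y)
      (r : EndVal A c z) := by
    refine MultilinearMap.ext fun v => ?_
    change p (outerTuple A s₁ (outerTuple A s₂ v (r (innerTuple A s₂ v)))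
        (q (innerTuple A s₁ (outerTuple A s₂ v (r (innerTuple A s₂ v)))))) =
      p (outerTuple A s₄ v (q (outerTuple A s₃ (innerTuple A s₄ v)
        (r (innerTuple A s₃ (innerTuple A s₄ v))))))
    rw [inner_seq A s₁ s₂ s₃ s₄, inner_outer_seq A s₁ s₂ s₃ s₄, outer_outer_seq A s₁ s₂ s₃ s₄]
  assoc_par {a b c t u w i j y z} hij s₁ s₂ s₃ s₄ x (p : EndVal A a x) (q : EndVal A b y)
      (r : EndVal A c z) := by
    refine MultilinearMap.ext fun v => ?_
    change p (outerTuple A s₁ (outerTuple A s₂ v (r (innerTuple A s₂ v)))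
        (q (innerTuple A s₁ (outerTuple A s₂ v (r (innerTuple A s₂ v)))))) =
      p (outerTuple A s₃ (outerTuple A s₄ v (q (innerTuple A s₄ v)))
        (r (innerTuple A s₃ (outerTuple A s₄ v (q (innerTuple A s₄ v))))))
    rw [inner_par A hij s₁ s₂ s₃ s₄, inner_par A hij.symm s₃ s₄ s₁ s₂,
      outer_par A hij s₁ s₂ s₃ s₄]

end Algebras

end HyperOp
namespace HyperOp

section Algebras

variable {k : Type u} [Field k] {C : Type u} [SmallCategory C]

/-- An algebra of a `C`-operad `P`: a functor `A : C ⥤ Vect` and a morphism `P ⟶ End_A`. -/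
structure COperad.Algebra (P : COperad k C) where
  functor : C ⥤ ModuleCat.{u} k
  structureMap : P ⟶ endOperad functor

/-- The multilinear map `A(c₁) × ⋯ × A(cₙ) ⟶ A(c)` by which an operation acts on an algebra. -/
noncomputable def COperad.Algebra.eval {P : COperad k C} (A : P.Algebra) {a : Tup C} {x : C}
    (p : P.coll.val a x) : EndVal A.functor a x :=
  COperad.Hom.apply A.structureMap p

/-- Morphisms of algebras: natural transformations which commute with all operations. -/
@[ext]
structure COperad.Algebra.Hom {P : COperad k C} (A B : P.Algebra) where
  toNatTrans : A.functor ⟶ B.functor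
  map_eval {a : Tup C} {x : C} (p : P.coll.val a x) (v : ∀ j, A.functor.obj (a.col j)) :
    (toNatTrans.app x).hom (A.eval p v) = B.eval p fun j => (toNatTrans.app (a.col j)).hom (v j)

instance (P : COperad k C) : Category.{u} P.Algebra where
  Hom := COperad.Algebra.Hom
  id A := ⟨𝟙 _, fun _ _ => rfl⟩
  comp f g := ⟨f.toNatTrans ≫ g.toNatTrans, fun p v => by
    simp only [NatTrans.comp_app, ModuleCat.hom_comp, LinearMap.comp_apply, f.map_eval,
      g.map_eval]⟩

end Algebras

section Collections

variable (k : Type u) [Field k] {C : Type u} [SmallCategory C]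

/-- The elements `(*, σ₁ … σₙ; π)`, where `*` is an element of the set `G(c₁ … cₙ; c)`, and
`σᵢ : c'ᵢ ⟶ cᵢ` and `π : c ⟶ c'` are morphisms of `C`. -/
structure FreeAction (G : ∀ n : ℕ, (Fin n → C) → C → Type u) (n : ℕ) (c' : Fin n → C) (x' : C) where
  {inputs : Fin n → C}
  {output : C}
  symbol : G n inputs output
  inMap : ∀ i, c' i ⟶ inputs i
  outMap : output ⟶ x'

/-- The non-symmetric `C`-collection freely generated by sets `G(c₁ … cₙ; c)`, i.e. the left Kan
extension of the collection of vector spaces `k[G(c₁ … cₙ; c)]` along the inclusion of the discrete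
category of objects of `(Cᵒᵖ)ⁿ × C`. -/
noncomputable def freeCollection (G : ∀ n : ℕ, (Fin n → C) → C → Type u) : NSCollection k C :=
  fun n =>
  { obj := fun d => ModuleCat.of k (FreeAction G n (fun i => (d.1 i).unop) d.2 →₀ k)
    map := fun f => ModuleCat.ofHom (Finsupp.lmapDomain k k fun e =>
      ⟨e.symbol, fun i => (f.1 i).unop ≫ e.inMap i, e.outMap ≫ f.2⟩)
    map_id := fun d => by
      ext e
      simp
    map_comp := fun f g => by
      ext e
      simp [Finsupp.mapDomain_single] }

variable {k}

/-- The subspaces spanned by the differences of the pairs of the smallest equivalence relation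
(subfunctor of `X × X`) on a non-symmetric collection `X` which contains the pairs in `R`. -/
def relSpan (X : NSCollection k C)
    (R : ∀ (n : ℕ) (c : Fin n → C) (x : C), (X n).obj (fun i => op (c i), x) →
      (X n).obj (fun i => op (c i), x) → Prop) (n : ℕ) (d : (Fin n → Cᵒᵖ) × C) :
    Submodule k ((X n).obj d) :=
  Submodule.span k {v | ∃ (c : Fin n → C) (x : C)
    (f : ((fun i => op (c i), x) : (Fin n → Cᵒᵖ) × C) ⟶ d) (p q : (X n).obj (fun i => op (c i), x)),
    R n c x p q ∧ v = ((X n).map f).hom p - ((X n).map f).hom q}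

lemma relSpan_map (X : NSCollection k C)
    (R : ∀ (n : ℕ) (c : Fin n → C) (x : C), (X n).obj (fun i => op (c i), x) →
      (X n).obj (fun i => op (c i), x) → Prop) (n : ℕ) {d e : (Fin n → Cᵒᵖ) × C} (f : d ⟶ e) :
    relSpan X R n d ≤ (relSpan X R n e).comap ((X n).map f).hom := by
  refine Submodule.span_le.mpr ?_
  rintro v ⟨c, x, g, p, q, hR, rfl⟩
  refine Submodule.subset_span ⟨c, x, g ≫ f, p, q, hR, ?_⟩
  rw [Functor.map_comp]
  exact map_sub _ _ _

/-- The quotient of a non-symmetric collection by the equivalence relation generated by `R`. -/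
def quotientCollection (X : NSCollection k C)
    (R : ∀ (n : ℕ) (c : Fin n → C) (x : C), (X n).obj (fun i => op (c i), x) →
      (X n).obj (fun i => op (c i), x) → Prop) : NSCollection k C :=
  fun n =>
  { obj := fun d => ModuleCat.of k ((X n).obj d ⧸ relSpan X R n d)
    map := fun {d e} f => ModuleCat.ofHom
      (Submodule.mapQ (relSpan X R n d) (relSpan X R n e) ((X n).map f).hom (relSpan_map X R n f))
    map_id := fun d => by
      ext x
      simp
    map_comp := fun f g => by
      ext x
      change Submodule.Quotient.mk (((X n).map (f ≫ g)).hom x) =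
        Submodule.Quotient.mk (((X n).map g).hom (((X n).map f).hom x))
      rw [Functor.map_comp]
      rfl }

end Collections

/-! ### The operad for Markl operads -/

section Hyperoperad

variable (k : Type u) [Field k] {O : Type u} [SmallCategory O]

/-- An object of `O`, as a color, i.e. an object of the category `O_isoᵒᵖ`. -/
abbrev colorOf (T : O) : (Core O)ᵒᵖ := op ⟨T⟩

/-- The morphism `T'' ⟶ T'` of `O_isoᵒᵖ` given by an isomorphism `T' ≅ T''` of `O`. -/
abbrev colorHom {T' T'' : O} (ω : T' ≅ T'') : colorOf T'' ⟶ colorOf T' :=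
  Quiver.Hom.op (⟨ω⟩ : (⟨T'⟩ : Core O) ⟶ ⟨T''⟩)

section Lists

variable {C : Type u} [SmallCategory C]

/-- A pair of morphisms between lists with two entries. -/
def pairHom {a b a' b' : C} (f : a ⟶ a') (g : b ⟶ b') : ∀ i : Fin 2, ![a, b] i ⟶ ![a', b'] i
  | 0 => f
  | 1 => g

lemma isSplice_fst {C : Type u} (a b c d : C) : IsSplice ⟨2, ![a, b]⟩ 0 ⟨2, ![c, d]⟩ a ⟨3, ![c, d, b]⟩ where
  len_eq := rfl
  col_eq := rfl
  col_outer j := by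
    obtain ⟨j, hj⟩ := j
    fin_cases j
    · exact absurd rfl hj
    · rfl
  col_inner q := by
    fin_cases q <;> rfl

lemma isSplice_snd {C : Type u} (a b c d : C) : IsSplice ⟨2, ![a, b]⟩ 1 ⟨2, ![c, d]⟩ b ⟨3, ![a, c, d]⟩ where
  len_eq := rfl
  col_eq := rfl
  col_outer j := by
    obtain ⟨j, hj⟩ := j
    fin_cases j
    · rfl
    · exact absurd rfl hj
  col_inner q := by
    fin_cases q <;> rfl

/-- The morphism of lists which swaps the second and the third entry. -/
def swapHom (a b c : C) : (⟨3, ![a, c, b]⟩ : Tup C) ⟶ ⟨3, ![a, b, c]⟩ where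
  perm := Equiv.swap 1 2
  map i := eqToHom (by fin_cases i <;> rfl)

end Lists

variable [GradedOperadicCategory O]

/-- The symbols `*_φ ∈ X(S F; T)`, for elementary morphisms `φ : F ▷ T ⟶ S`. -/
inductive ElementarySymbol (O : Type u) [SmallCategory O] [GradedOperadicCategory O] :
    ∀ n : ℕ, (Fin n → (Core O)ᵒᵖ) → (Core O)ᵒᵖ → Type u
  | star {F T S : O} (φ : Elementary F T S) :
      ElementarySymbol O 2 ![colorOf S, colorOf F] (colorOf T)

/-- The collection `X`: symbols `*_φ` with free actions on the inputs and on the output. -/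
noncomputable abbrev symbolCollection (O : Type u) [SmallCategory O] [GradedOperadicCategory O] :
    NSCollection k (Core O)ᵒᵖ :=
  freeCollection k (ElementarySymbol O)

/-- The element `(*_φ, σ τ; π) ∈ X(s f; t)`. -/
noncomputable def symbolElem {F T S : O} (φ : Elementary F T S) {s f t : (Core O)ᵒᵖ}
    (σ : s ⟶ colorOf S) (τ : f ⟶ colorOf F) (π : colorOf T ⟶ t) :
    (symbolCollection k O 2).obj (fun i => op (![s, f] i), t) :=
  Finsupp.single (⟨ElementarySymbol.star φ, pairHom σ τ, π⟩ :
    FreeAction (ElementarySymbol O) 2 ![s, f] t) (1 : k)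

/-- The relation which makes the symbols `*_φ` equivariant: a square `φ' ≫ σ = ω ≫ φ''` with
`φ', φ''` elementary, `ω` an isomorphism and `σ` a quasibijection identifies `*_φ''`, acted on by
`ω` on the output, with `*_φ'`, acted on by `σ` and the induced isomorphism of the nontrivial fibers
on the inputs. -/
inductive SymbolRel : ∀ (n : ℕ) (c : Fin n → (Core O)ᵒᵖ) (x : (Core O)ᵒᵖ),
    (symbolCollection k O n).obj (fun i => op (c i), x) →
      (symbolCollection k O n).obj (fun i => op (c i), x) → Prop
  | equivariance {F' T' S' F'' T'' S'' : O} (φ' : Elementary F' T' S')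
      (φ'' : Elementary F'' T'' S'') (ω : T' ≅ T'') (σ : S' ≅ S'')
      (hσ : IsQuasibijection σ.hom) (w : φ'.hom ≫ σ.hom = ω.hom ≫ φ''.hom) :
      SymbolRel 2 ![colorOf S'', colorOf F''] (colorOf T')
        (symbolElem k φ'' (𝟙 _) (𝟙 _) (colorHom ω))
        (symbolElem k φ' (colorHom σ) (colorHom (φ'.fiberIso φ'' ω σ.hom hσ w)) (𝟙 _))

/-- The collection `Q = X/Eq` of generators. -/
noncomputable def generators (O : Type u) [SmallCategory O] [GradedOperadicCategory O] :
    NSCollection k (Core O)ᵒᵖ :=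
  quotientCollection (symbolCollection k O) (SymbolRel k)

/-- The operation `[*_φ] ∈ F(Q)(S F; T)`. -/
noncomputable def starOp {F T S : O} (φ : Elementary F T S) :
    (FreeOperad (generators k O)).coll.val ⟨2, ![colorOf S, colorOf F]⟩ (colorOf T) :=
  FreeOperad.gen (generators k O) ![colorOf S, colorOf F] (colorOf T)
    (Submodule.Quotient.mk (symbolElem k φ (𝟙 _) (𝟙 _) (𝟙 _)))

/-- The sequential and parallel associators. -/
inductive IsAssociator : ∀ (a : Tup (Core O)ᵒᵖ) (x : (Core O)ᵒᵖ),
    (FreeOperad (generators k O)).coll.val a x → Prop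
  /-- For `φ : F ▷_j T ⟶ S` and `ψ : G ▷_i S ⟶ P` with `|ψ|(j) = i`: the difference of the two
  composites in `F(Q)(P G F; T)`. -/
  | sequential {F T S G P : O} (φ : Elementary F T S) (ψ : Elementary G S P)
      (h : cardMap ψ.hom φ.idx = ψ.idx) :
      IsAssociator ⟨3, ![colorOf P, colorOf G, colorOf F]⟩ (colorOf T)
        ((FreeOperad (generators k O)).comp (isSplice_fst _ _ _ _) _ (starOp k φ) (starOp k ψ) -
          (FreeOperad (generators k O)).comp (isSplice_snd _ _ _ _) _ (starOp k (φ.comp ψ h))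
            (starOp k (φ.onFiber ψ h)))
  /-- For a commutative square of elementary morphisms with disjoint fibers: the difference of the
  two composites in `F(Q)(S F'' F'; T)`. -/
  | parallel {F' F'' T P' P'' S : O} (φ' : Elementary F' T P') (ψ' : Elementary F'' P' S)
      (φ'' : Elementary F'' T P'') (ψ'' : Elementary F' P'' S)
      (w : φ'.hom ≫ ψ'.hom = φ''.hom ≫ ψ''.hom) (h' : cardMap ψ'.hom φ'.idx = ψ''.idx)
      (h'' : cardMap ψ''.hom φ''.idx = ψ'.idx) (hne : ψ'.idx ≠ ψ''.idx) :
      IsAssociator ⟨3, ![colorOf S, colorOf F'', colorOf F']⟩ (colorOf T)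
        ((FreeOperad (generators k O)).comp (isSplice_fst _ _ _ _) _ (starOp k φ') (starOp k ψ') -
          (FreeOperad (generators k O)).coll.act (swapHom _ _ _) (𝟙 _)
            ((FreeOperad (generators k O)).comp (isSplice_fst _ _ _ _) _ (starOp k φ'')
              (starOp k ψ'')))

/-- The `O_isoᵒᵖ`-operad `H_O = F(Q)/(associators)`. -/
noncomputable def hyperoperad (O : Type u) [SmallCategory O] [GradedOperadicCategory O] :
    COperad k (Core O)ᵒᵖ :=
  (FreeOperad (generators k O)).quotient
    ((FreeOperad (generators k O)).idealSpan fun a x => {p | IsAssociator k a x p})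

/-! ### Markl operads -/

/-- A (non-unital) Markl `O`-operad in vector spaces: a functor `M : O_isoᵒᵖ ⥤ Vect` with operations
`∘_φ : M(S) ⊗ M(F) ⟶ M(T)` for the elementary morphisms `φ : F ▷ T ⟶ S`. -/
structure MarklOperad (O : Type u) [SmallCategory O] [GradedOperadicCategory O] where
  functor : (Core O)ᵒᵖ ⥤ ModuleCat.{u} k
  /-- the operation `∘_φ` -/
  circ {F T S : O} (φ : Elementary F T S) :
    functor.obj (colorOf S) →ₗ[k] functor.obj (colorOf F) →ₗ[k] functor.obj (colorOf T)
  equivariance {F' T' S' F'' T'' S'' : O} (φ' : Elementary F' T' S')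
    (φ'' : Elementary F'' T'' S'') (ω : T' ≅ T'') (σ : S' ≅ S'')
    (hσ : IsQuasibijection σ.hom) (w : φ'.hom ≫ σ.hom = ω.hom ≫ φ''.hom)
    (s : functor.obj (colorOf S'')) (f : functor.obj (colorOf F'')) :
    (functor.map (colorHom ω)).hom (circ φ'' s f) =
      circ φ' ((functor.map (colorHom σ)).hom s)
        ((functor.map (colorHom (φ'.fiberIso φ'' ω σ.hom hσ w))).hom f)
  sequential {F T S G P : O} (φ : Elementary F T S) (ψ : Elementary G S P)
    (h : cardMap ψ.hom φ.idx = ψ.idx) (p : functor.obj (colorOf P)) (g : functor.obj (colorOf G))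
    (f : functor.obj (colorOf F)) :
    circ φ (circ ψ p g) f = circ (φ.comp ψ h) p (circ (φ.onFiber ψ h) g f)
  parallel {F' F'' T P' P'' S : O} (φ' : Elementary F' T P') (ψ' : Elementary F'' P' S)
    (φ'' : Elementary F'' T P'') (ψ'' : Elementary F' P'' S)
    (w : φ'.hom ≫ ψ'.hom = φ''.hom ≫ ψ''.hom) (h' : cardMap ψ'.hom φ'.idx = ψ''.idx)
    (h'' : cardMap ψ''.hom φ''.idx = ψ'.idx) (hne : ψ'.idx ≠ ψ''.idx)
    (s : functor.obj (colorOf S)) (f'' : functor.obj (colorOf F''))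
    (f' : functor.obj (colorOf F')) :
    circ φ' (circ ψ' s f'') f' = circ φ'' (circ ψ'' s f') f''

/-- Morphisms of Markl operads: natural transformations which commute with all `∘_φ`. -/
@[ext]
structure MarklOperad.Hom {k : Type u} [Field k] {O : Type u} [SmallCategory O]
    [GradedOperadicCategory O] (M N : MarklOperad k O) where
  toNatTrans : M.functor ⟶ N.functor
  map_circ {F T S : O} (φ : Elementary F T S) (s : M.functor.obj (colorOf S))
    (f : M.functor.obj (colorOf F)) :
    (toNatTrans.app (colorOf T)).hom (M.circ φ s f) =
      N.circ φ ((toNatTrans.app (colorOf S)).hom s) ((toNatTrans.app (colorOf F)).hom f)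

instance : Category.{u} (MarklOperad k O) where
  Hom := MarklOperad.Hom
  id M := ⟨𝟙 _, fun _ _ _ => rfl⟩
  comp f g := ⟨f.toNatTrans ≫ g.toNatTrans, fun φ s x => by
    simp only [NatTrans.comp_app, ModuleCat.hom_comp, LinearMap.comp_apply, f.map_circ,
      g.map_circ]⟩

end Hyperoperad

end HyperOp

namespace HyperOp

/-! ### Universal properties of free operads, quotient operads and presented collections. -/

section UniversalProperties

variable {k : Type u} [Field k] {C : Type u} [SmallCategory C]

/-! The operad `hyperoperad k O` is given by generators and relations, so a morphism from it to any
operad is a choice of images of the generators that satisfies the relations. For the target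
`endOperad A` this data is exactly a Markl operad structure on the functor `A`. A symbol `*_φ` goes
to an operation with two inputs, that is, to a bilinear map `A(S) × A(F) → A(T)`, which is `∘_φ`.
The choice descends to the quotient `Q = X/Eq` by the equivariance axiom, and the extension to the
free operad kills the two kinds of associators by the sequential and parallel axioms.

Existence of the morphism is obtained by composing four universal properties: `freeCollectionLift`
for the freely generated collection, `quotientCollectionLift` for its quotient, `FreeOperad.lift`
for the free operad and `COperad.quotientLift` for the quotient by the ideal. Uniqueness is
`hyperoperad_induction`: every operation arises from the classes `starClass k φ` by linear
combinations, actions and compositions. The same induction shows that a natural transformation that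
respects all `∘_φ` respects all operations (`natTrans_eval`), so the morphisms on both sides agree
as well.

The two passages never change the functor `A` or the natural transformations; they only exchange the
structure map for the family of bilinear maps. Hence they are inverse to each other on the nose,
which gives an isomorphism of categories (`toAlgebra_toMarkl`, `MarklOperad.toMarkl_toAlgebra`).

Binary quadraticity can be read off the presentation: symbols have two inputs, and each associator
is a difference of composites of two of them (`subsingleton_generators`, `isWeight_associator`). -/

lemma Collection.act_id (P : Collection k C) {a : Tup C} {x : C} (p : P.val a x) :
    P.act (𝟙 a) (𝟙 x) p = p := by
  change (P.map (𝟙 (op a, x))).hom p = p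
  simp

lemma Collection.act_act (P : Collection k C) {a b c : Tup C} {x y z : C} (f : b ⟶ a)
    (f' : c ⟶ b) (g : x ⟶ y) (g' : y ⟶ z) (p : P.val a x) :
    P.act f' g' (P.act f g p) = P.act (f' ≫ f) (g ≫ g') p := by
  change (P.map (f'.op ×ₘ g')).hom ((P.map (f.op ×ₘ g)).hom p) =
    (P.map ((f.op ×ₘ g) ≫ (f'.op ×ₘ g'))).hom p
  rw [Functor.map_comp]
  rfl

lemma COperad.Hom.apply_act {P Q : COperad k C} (f : P ⟶ Q) {a b : Tup C} {x y : C} (g : b ⟶ a)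
    (h : x ⟶ y) (p : P.coll.val a x) :
    COperad.Hom.apply f (P.coll.act g h p) = Q.coll.act g h (COperad.Hom.apply f p) :=
  LinearMap.congr_fun (congrArg ModuleCat.Hom.hom
    ((COperad.Hom.toNatTrans f).naturality (g.op ×ₘ h))) p

lemma COperad.Hom.apply_comp {P Q : COperad k C} (f : P ⟶ Q) {a : Tup C} {i : Fin a.len}
    {b : Tup C} {y : C} {t : Tup C} (s : IsSplice a i b y t) (x : C) (p : P.coll.val a x)
    (q : P.coll.val b y) :
    COperad.Hom.apply f (P.comp s x p q) =
      Q.comp s x (COperad.Hom.apply f p) (COperad.Hom.apply f q) :=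
  COperad.Hom.map_comp f s x p q

/-- Compatibility with compositions is a proposition, so a morphism is determined by its components,
and every object of `(Tup C)ᵒᵖ × C` is a pair `(op a, x)`. -/
lemma COperad.Hom.ext_apply {P Q : COperad k C} {f g : P ⟶ Q}
    (h : ∀ (a : Tup C) (x : C) (p : P.coll.val a x),
      COperad.Hom.apply f p = COperad.Hom.apply g p) : f = g := by
  refine COperad.Hom.ext (NatTrans.ext (funext fun d => ?_))
  exact ModuleCat.hom_ext (LinearMap.ext fun p => h d.1.unop d.2 p)

/-- The morphism `(c'₁ … c'ₙ) ⟶ (c₁ … cₙ)` of `𝕊C` with the identity permutation. -/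
def Tup.homOfFamily {n : ℕ} {c' c : Fin n → C} (f : ∀ i, c' i ⟶ c i) :
    (⟨n, c'⟩ : Tup C) ⟶ ⟨n, c⟩ :=
  ⟨Equiv.refl _, f⟩

/-- Morphisms from a non-symmetric collection to the collection underlying an operad. -/
structure NSCollection.HomTo (X : NSCollection k C) (P : COperad k C) where
  app {n : ℕ} (c : Fin n → C) (x : C) :
    (X n).obj (fun i => op (c i), x) →ₗ[k] P.coll.val ⟨n, c⟩ x
  app_map {n : ℕ} {c c' : Fin n → C} {x y : C} (f : ∀ i, c' i ⟶ c i) (g : x ⟶ y)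
    (p : (X n).obj (fun i => op (c i), x)) :
    app c' y (((X n).map (Prod.mkHom (X₁ := fun i => op (c i)) (X₂ := fun i => op (c' i))
      (fun i => (f i).op) g)).hom p) = P.coll.act (Tup.homOfFamily f) g (app c x p)

/-! ### The free operad: extending a map of generators. -/

section Free

variable {X : NSCollection k C} {P : COperad k C}

/-- The value of a formal expression in an operad. -/
def FreePre.eval (φ : X.HomTo P) : ∀ {a : Tup C} {x : C}, FreePre X a x → P.coll.val a x
  | _, _, .gen p => φ.app _ _ p
  | _, _, .zero => 0
  | _, _, .add p q => p.eval φ + q.eval φ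
  | _, _, .smul r p => r • p.eval φ
  | _, _, .act f g p => P.coll.act f g (p.eval φ)
  | _, _, .comp s p q => P.comp s _ (p.eval φ) (q.eval φ)

/-- Each constructor of `Rel` is an instance of an axiom that holds in the target: a vector space
axiom, functoriality or linearity of the action, bilinearity of the composition, an operad axiom, or
a property of `φ`. This is what makes evaluation well defined on `FreeVal`. -/
lemma FreePre.Rel.eval_eq (φ : X.HomTo P) {a : Tup C} {x : C} {p q : FreePre X a x}
    (h : FreePre.Rel p q) : p.eval φ = q.eval φ := by
  induction h with
  | refl => rfl
  | symm _ ih => exact ih.symm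
  | trans _ _ ih ih' => exact ih.trans ih'
  | add_congr _ _ ih ih' => simp only [FreePre.eval, ih, ih']
  | smul_congr _ _ ih => simp only [FreePre.eval, ih]
  | act_congr _ _ _ ih => simp only [FreePre.eval, ih]
  | comp_congr _ _ _ ih ih' => simp only [FreePre.eval, ih, ih']
  | add_assoc => exact _root_.add_assoc _ _ _
  | add_comm => exact _root_.add_comm _ _
  | zero_add => exact _root_.zero_add _
  | neg_add_cancel => simp [FreePre.eval]
  | one_smul => exact _root_.one_smul _ _
  | mul_smul => exact SemigroupAction.mul_smul _ _ _
  | smul_add => exact _root_.smul_add _ _ _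
  | add_smul => exact _root_.add_smul _ _ _
  | zero_smul => exact _root_.zero_smul _ _
  | smul_zero => exact _root_.smul_zero _
  | gen_add => exact map_add _ _ _
  | gen_smul => exact map_smul _ _ _
  -- Naturality of `φ` enters only here; `gen_add` and `gen_smul` use its linearity.
  | gen_act f g p => exact (φ.app_map f g p).symm
  | act_id => exact P.coll.act_id _
  | act_act => exact (P.coll.act_act _ _ _ _ _).symm
  | act_add => exact map_add _ _ _
  | act_smul => exact map_smul _ _ _
  | comp_add_left => simp only [FreePre.eval, map_add, LinearMap.add_apply]
  | comp_smul_left => simp only [FreePre.eval, map_smul, LinearMap.smul_apply]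
  | comp_add_right => simp only [FreePre.eval, map_add]
  | comp_smul_right => simp only [FreePre.eval, map_smul]
  | comp_act_output => exact P.comp_act_output _ _ _ _
  | comp_act_input s f s' g x p q => exact P.comp_act_input s f s' g x _ _
  | assoc_seq s₁ s₂ s₃ s₄ => exact P.assoc_seq s₁ s₂ s₃ s₄ _ _ _ _
  | assoc_par hij s₁ s₂ s₃ s₄ => exact P.assoc_par hij s₁ s₂ s₃ s₄ _ _ _ _

/-- The linear maps underlying the extension of a morphism `X ⟶ P` to the free operad. -/
def FreeVal.lift (φ : X.HomTo P) (a : Tup C) (x : C) : FreeVal X a x →ₗ[k] P.coll.val a x where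
  toFun := Quotient.lift (FreePre.eval φ) fun _ _ h => FreePre.Rel.eval_eq φ h
  map_add' := by
    rintro ⟨p⟩ ⟨q⟩
    rfl
  map_smul' := by
    rintro r ⟨p⟩
    rfl

/-- The extension of a morphism `X ⟶ P` to the free operad on `X`. -/
def FreeOperad.lift (φ : X.HomTo P) : FreeOperad X ⟶ P where
  toNatTrans :=
    { app := fun d => ModuleCat.ofHom (FreeVal.lift φ d.1.unop d.2)
      naturality := fun d e f => by
        ext ⟨p⟩
        rfl }
  map_comp s x := by
    rintro ⟨p⟩ ⟨q⟩
    rfl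

/-- Together with its linearity, this makes `gen` a morphism of non-symmetric collections. It allows
the maps attached to a symbol to be pulled out as an action, see `gen_single`. -/
lemma FreeOperad.gen_map {n : ℕ} {c c' : Fin n → C} {x y : C} (f : ∀ i, c' i ⟶ c i) (g : x ⟶ y)
    (p : (X n).obj (fun i => op (c i), x)) :
    FreeOperad.gen X c' y (((X n).map (Prod.mkHom (X₁ := fun i => op (c i))
      (X₂ := fun i => op (c' i)) (fun i => (f i).op) g)).hom p) =
      (FreeOperad X).coll.act (Tup.homOfFamily f) g (FreeOperad.gen X c x p) :=
  (FreeVal.sound (.gen_act f g p)).symm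

end Free

/-! ### Ideals, kernels and quotient operads. -/

section Quotients

variable {P Q : COperad k C}

/-- The kernel of a morphism of operads. -/
def COperad.Hom.ker (f : P ⟶ Q) : P.Ideal where
  carrier a x := LinearMap.ker (COperad.Hom.apply f : P.coll.val a x →ₗ[k] Q.coll.val a x)
  act_mem g h p hp := by
    rw [LinearMap.mem_ker] at hp ⊢
    rw [COperad.Hom.apply_act, hp, map_zero]
  comp_mem_left s x p hp q := by
    rw [LinearMap.mem_ker] at hp ⊢
    rw [COperad.Hom.apply_comp, hp, map_zero, LinearMap.zero_apply]
  comp_mem_right s x p q hq := by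
    rw [LinearMap.mem_ker] at hq ⊢
    rw [COperad.Hom.apply_comp, hq, map_zero]

lemma COperad.subset_idealSpan (A : ∀ (a : Tup C) (x : C), Set (P.coll.val a x)) (a : Tup C)
    (x : C) : A a x ⊆ (P.idealSpan A).carrier a x := fun _ hp =>
  (Submodule.mem_iInf _).mpr fun I => I.2 a x hp

/-- With `I` the kernel of a morphism, this reduces the vanishing of that morphism on a generated
ideal to its vanishing on the generators. -/
lemma COperad.idealSpan_le {A : ∀ (a : Tup C) (x : C), Set (P.coll.val a x)} {I : P.Ideal}
    (h : ∀ a x, A a x ⊆ I.carrier a x) (a : Tup C) (x : C) :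
    (P.idealSpan A).carrier a x ≤ I.carrier a x :=
  iInf_le (fun I : {I : P.Ideal // ∀ a x, A a x ⊆ I.carrier a x} => I.1.carrier a x) ⟨I, h⟩

/-- A morphism of operads which vanishes on an ideal, as a morphism from the quotient. -/
def COperad.quotientLift (I : P.Ideal) (f : P ⟶ Q)
    (h : ∀ a x, I.carrier a x ≤ (COperad.Hom.ker f).carrier a x) : P.quotient I ⟶ Q where
  toNatTrans :=
    { app := fun d => ModuleCat.ofHom
        ((I.carrier d.1.unop d.2).liftQ (COperad.Hom.apply f) (h d.1.unop d.2))
      naturality := fun d e g => by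
        ext p
        obtain ⟨p, rfl⟩ := P.quotientMk_surjective I _ _ p
        exact COperad.Hom.apply_act f g.1.unop g.2 p }
  map_comp s x p q := by
    obtain ⟨p, rfl⟩ := P.quotientMk_surjective I _ _ p
    obtain ⟨q, rfl⟩ := P.quotientMk_surjective I _ _ q
    exact COperad.Hom.apply_comp f s x p q

end Quotients

/-! ### Freely generated collections and their quotients. -/

section Collections

variable {G : ∀ n : ℕ, (Fin n → C) → C → Type u} {P : COperad k C}

/-- The value in an operad of an element of the collection freely generated by `G`. -/
noncomputable def freeCollectionLift (φ : ∀ {n : ℕ} {c : Fin n → C} {x : C}, G n c x →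
    P.coll.val ⟨n, c⟩ x) : (freeCollection k G).HomTo P where
  app c x := Finsupp.linearCombination k fun e : FreeAction G _ c x =>
    P.coll.act (Tup.homOfFamily e.inMap) e.outMap (φ e.symbol)
  app_map {n c c' x y} f g p := by
    -- Both sides are linear in `p`, so it suffices to compare them on basis elements. There the
    -- collection acts by composing with the attached maps, and `act_act` does the same in `P`.
    refine LinearMap.congr_fun (f := (Finsupp.linearCombination k _).comp
      (Finsupp.lmapDomain k k _)) (g := (P.coll.act (Tup.homOfFamily f) g).comp
      (Finsupp.linearCombination k _)) (Finsupp.lhom_ext fun e r => ?_) p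
    simp only [LinearMap.comp_apply, Finsupp.lmapDomain_apply, Finsupp.mapDomain_single,
      Finsupp.linearCombination_single, map_smul, P.coll.act_act]
    rfl

lemma freeCollectionLift_single (φ : ∀ {n : ℕ} {c : Fin n → C} {x : C}, G n c x →
    P.coll.val ⟨n, c⟩ x) {n : ℕ} {c : Fin n → C} {x : C} (e : FreeAction G n c x) :
    (freeCollectionLift (k := k) φ).app c x (Finsupp.single e (1 : k)) =
      P.coll.act (Tup.homOfFamily e.inMap) e.outMap (φ e.symbol) :=
  (Finsupp.linearCombination_single k 1 e).trans (one_smul k _)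

variable {X : NSCollection k C}
  {R : ∀ (n : ℕ) (c : Fin n → C) (x : C), (X n).obj (fun i => op (c i), x) →
      (X n).obj (fun i => op (c i), x) → Prop}

/-- A morphism `X ⟶ P` which identifies the pairs in `R`, as a morphism from the quotient. -/
def quotientCollectionLift (φ : X.HomTo P)
    (h : ∀ (n : ℕ) (c : Fin n → C) (x : C) (p q : (X n).obj (fun i => op (c i), x)),
      R n c x p q → φ.app c x p = φ.app c x q) : (quotientCollection X R).HomTo P where
  app {n} c x := (relSpan X R n (fun i => op (c i), x)).liftQ (φ.app c x) (by
    refine Submodule.span_le.mpr ?_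
    rintro _ ⟨c', x', f, p, q, hpq, rfl⟩
    -- The spanning vectors of `relSpan` are differences of images of `R`-related pairs under
    -- arbitrary `f`. Naturality of `φ` pulls `f` out, and then `h` applies to the pair itself.
    have key : ∀ r, φ.app c x (((X n).map f).hom r) =
        P.coll.act (Tup.homOfFamily fun i => (f.1 i).unop) f.2 (φ.app c' x' r) :=
      fun r => φ.app_map (fun i => (f.1 i).unop) f.2 r
    rw [SetLike.mem_coe, LinearMap.mem_ker, map_sub, key, key, h _ _ _ _ _ hpq, sub_self])
  app_map f g p := by
    obtain ⟨p, rfl⟩ := Submodule.Quotient.mk_surjective _ p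
    exact φ.app_map f g p

end Collections

end UniversalProperties

/-! ### Endomorphism operads in low arity: bilinear maps and explicit composites. -/

section Binary

variable {k : Type u} [Field k] {C : Type u} [SmallCategory C] (A : C ⥤ ModuleCat.{u} k)

/-- The tuple with the two entries `v` and `w`. -/
def pairTuple {a b : C} (v : A.obj a) (w : A.obj b) :
    ∀ j : Fin (⟨2, ![a, b]⟩ : Tup C).len, A.obj ((⟨2, ![a, b]⟩ : Tup C).col j)
  | 0 => v
  | 1 => w

/-- The tuple with the three entries `v`, `w` and `z`. -/
def tripleTuple {a b c : C} (v : A.obj a) (w : A.obj b) (z : A.obj c) :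
    ∀ j : Fin (⟨3, ![a, b, c]⟩ : Tup C).len, A.obj ((⟨3, ![a, b, c]⟩ : Tup C).col j)
  | 0 => v
  | 1 => w
  | 2 => z

/-- The type of an entry depends on its index. Splitting into the two literal indices lets `![a, b]
j` reduce to `a` or `b`, so no transport appears in the hypotheses. -/
lemma pairTuple_ext {a b : C} {v : ∀ j : Fin (⟨2, ![a, b]⟩ : Tup C).len,
    A.obj ((⟨2, ![a, b]⟩ : Tup C).col j)} {x : A.obj a} {y : A.obj b} (hx : v 0 = x)
    (hy : v 1 = y) : v = pairTuple A x y := by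
  funext j
  match j with
  | 0 => exact hx
  | 1 => exact hy

lemma exists_pairTuple {a b : C} (v : ∀ j : Fin (⟨2, ![a, b]⟩ : Tup C).len,
    A.obj ((⟨2, ![a, b]⟩ : Tup C).col j)) : ∃ (x : A.obj a) (y : A.obj b), v = pairTuple A x y :=
  ⟨v 0, v 1, pairTuple_ext A rfl rfl⟩

lemma tripleTuple_ext {a b c : C} {v : ∀ j : Fin (⟨3, ![a, b, c]⟩ : Tup C).len,
    A.obj ((⟨3, ![a, b, c]⟩ : Tup C).col j)} {x : A.obj a} {y : A.obj b} {z : A.obj c}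
    (hx : v 0 = x) (hy : v 1 = y) (hz : v 2 = z) : v = tripleTuple A x y z := by
  funext j
  match j with
  | 0 => exact hx
  | 1 => exact hy
  | 2 => exact hz

lemma exists_tripleTuple {a b c : C} (v : ∀ j : Fin (⟨3, ![a, b, c]⟩ : Tup C).len,
    A.obj ((⟨3, ![a, b, c]⟩ : Tup C).col j)) :
    ∃ (x : A.obj a) (y : A.obj b) (z : A.obj c), v = tripleTuple A x y z :=
  ⟨v 0, v 1, v 2, tripleTuple_ext A rfl rfl rfl⟩

lemma pairTuple_update_zero {a b : C} (v v' : A.obj a) (w : A.obj b) :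
    Function.update (pairTuple A v w) (0 : Fin 2) v' = pairTuple A v' w :=
  pairTuple_ext A (Function.update_self (0 : Fin 2) _ _)
    (Function.update_of_ne (Fin.zero_ne_one (n := 0)).symm _ _)

lemma pairTuple_update_one {a b : C} (v : A.obj a) (w w' : A.obj b) :
    Function.update (pairTuple A v w) (1 : Fin 2) w' = pairTuple A v w' :=
  pairTuple_ext A (Function.update_of_ne (Fin.zero_ne_one (n := 0)) _ _)
    (Function.update_self (1 : Fin 2) _ _)

/-- Operations of the endomorphism operad with two inputs, as bilinear maps. -/
def toBilinear {a b x : C} (φ : EndVal A ⟨2, ![a, b]⟩ x) :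
    A.obj a →ₗ[k] A.obj b →ₗ[k] A.obj x :=
  have h₀ (w : A.obj b) (u : A.obj a) := congrArg φ (pairTuple_update_zero A 0 u w)
  have h₁ (v : A.obj a) (u : A.obj b) := congrArg φ (pairTuple_update_one A v 0 u)
  LinearMap.mk₂ k (fun v w => φ (pairTuple A v w))
    (fun v v' w => (h₀ w (v + v')).symm.trans
      ((φ.map_update_add (pairTuple A 0 w) (0 : Fin 2) v v').trans
        (congrArg₂ (· + ·) (h₀ w v) (h₀ w v'))))
    (fun r v w => (h₀ w (r • v)).symm.trans
      ((φ.map_update_smul (pairTuple A 0 w) (0 : Fin 2) r v).trans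
        (congrArg (r • ·) (h₀ w v))))
    (fun v w w' => (h₁ v (w + w')).symm.trans
      ((φ.map_update_add (pairTuple A v 0) (1 : Fin 2) w w').trans
        (congrArg₂ (· + ·) (h₁ v w) (h₁ v w'))))
    (fun r v w => (h₁ v (r • w)).symm.trans
      ((φ.map_update_smul (pairTuple A v 0) (1 : Fin 2) r w).trans
        (congrArg (r • ·) (h₁ v w))))

/-- The left side has the shape in which the multilinearity goals of `ofBilinear` arrive; likewise
for `bilinear_update_one`. -/
lemma bilinear_update_zero {a b x : C} (β : A.obj a →ₗ[k] A.obj b →ₗ[k] A.obj x) (v : A.obj a)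
    (w : A.obj b) (u : A.obj a) :
    β (Function.update (pairTuple A v w) (0 : Fin 2) u (0 : Fin 2))
      (Function.update (pairTuple A v w) (0 : Fin 2) u (1 : Fin 2)) = β u w :=
  congrArg (fun t : ∀ j : Fin (⟨2, ![a, b]⟩ : Tup C).len,
    A.obj ((⟨2, ![a, b]⟩ : Tup C).col j) => β (t (0 : Fin 2)) (t (1 : Fin 2)))
    (pairTuple_update_zero A v u w)

lemma bilinear_update_one {a b x : C} (β : A.obj a →ₗ[k] A.obj b →ₗ[k] A.obj x) (v : A.obj a)
    (w u : A.obj b) :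
    β (Function.update (pairTuple A v w) (1 : Fin 2) u (0 : Fin 2))
      (Function.update (pairTuple A v w) (1 : Fin 2) u (1 : Fin 2)) = β v u :=
  congrArg (fun t : ∀ j : Fin (⟨2, ![a, b]⟩ : Tup C).len,
    A.obj ((⟨2, ![a, b]⟩ : Tup C).col j) => β (t (0 : Fin 2)) (t (1 : Fin 2)))
    (pairTuple_update_one A v w u)

/-- Bilinear maps as operations of the endomorphism operad. -/
def ofBilinear {a b x : C} (β : A.obj a →ₗ[k] A.obj b →ₗ[k] A.obj x) :
    EndVal A ⟨2, ![a, b]⟩ x where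
  toFun v := β (v (0 : Fin 2)) (v (1 : Fin 2))
  map_update_add' {inst} v i w w' := by
    -- The fields of `MultilinearMap` quantify over all decidability instances on the index type,
    -- while the update lemmas are stated for the standard one.
    obtain rfl : inst = instDecidableEqFin 2 := Subsingleton.elim _ _
    obtain ⟨v₀, v₁, rfl⟩ := exists_pairTuple A v
    match i with
    | 0 =>
      exact (bilinear_update_zero A β v₀ v₁ _).trans ((LinearMap.map_add₂ β _ _ _).trans
        (congrArg₂ (· + ·) (bilinear_update_zero A β v₀ v₁ w).symm
          (bilinear_update_zero A β v₀ v₁ w').symm))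
    | 1 =>
      exact (bilinear_update_one A β v₀ v₁ _).trans ((map_add (β v₀) _ _).trans
        (congrArg₂ (· + ·) (bilinear_update_one A β v₀ v₁ w).symm
          (bilinear_update_one A β v₀ v₁ w').symm))
  map_update_smul' {inst} v i r w := by
    obtain rfl : inst = instDecidableEqFin 2 := Subsingleton.elim _ _
    obtain ⟨v₀, v₁, rfl⟩ := exists_pairTuple A v
    match i with
    | 0 =>
      exact (bilinear_update_zero A β v₀ v₁ _).trans ((LinearMap.map_smul₂ β _ _ _).trans
        (congrArg (r • ·) (bilinear_update_zero A β v₀ v₁ w).symm))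
    | 1 =>
      exact (bilinear_update_one A β v₀ v₁ _).trans ((map_smul (β v₀) _ _).trans
        (congrArg (r • ·) (bilinear_update_one A β v₀ v₁ w).symm))

lemma ofBilinear_toBilinear {a b x : C} (φ : EndVal A ⟨2, ![a, b]⟩ x) :
    ofBilinear A (toBilinear A φ) = φ := by
  refine MultilinearMap.ext fun v => ?_
  obtain ⟨v₀, v₁, rfl⟩ := exists_pairTuple A v
  rfl

/-- For explicit lists the color equalities inside `innerTuple`, `outerTuple` and `swapHom` hold by
computation, so their transports are identities and are removed by this lemma. -/
lemma mapLin_eqToHom_rfl {x : C} (h : x = x) (v : A.obj x) : mapLin A (eqToHom h) v = v :=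
  mapLin_id A x v

/-- Inserting at the first place gives the list `c, d, b`: the first two entries feed `ψ`, and the
last one is the remaining input of `φ`. With `endComp_snd`, this evaluates every composite that
occurs in an associator. -/
lemma endComp_fst {a b c d x : C} (φ : EndVal A ⟨2, ![a, b]⟩ x) (ψ : EndVal A ⟨2, ![c, d]⟩ a)
    (v : A.obj c) (w : A.obj d) (z : A.obj b) :
    endComp A (isSplice_fst a b c d) x φ ψ (tripleTuple A v w z) =
      φ (pairTuple A (ψ (pairTuple A v w)) z) := by
  have hi : innerTuple A (isSplice_fst a b c d) (tripleTuple A v w z) = pairTuple A v w :=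
    pairTuple_ext A (mapLin_eqToHom_rfl A rfl v)
      (mapLin_eqToHom_rfl A rfl w)
  have ho : ∀ u, outerTuple A (isSplice_fst a b c d) (tripleTuple A v w z) u =
      pairTuple A u z := fun u =>
    pairTuple_ext A (mapLin_eqToHom_rfl A rfl u)
      (mapLin_eqToHom_rfl A rfl z)
  rw [endComp_apply, hi, ho]

lemma endComp_snd {a b c d x : C} (φ : EndVal A ⟨2, ![a, b]⟩ x) (ψ : EndVal A ⟨2, ![c, d]⟩ b)
    (v : A.obj a) (w : A.obj c) (z : A.obj d) :
    endComp A (isSplice_snd a b c d) x φ ψ (tripleTuple A v w z) =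
      φ (pairTuple A v (ψ (pairTuple A w z))) := by
  have hi : innerTuple A (isSplice_snd a b c d) (tripleTuple A v w z) = pairTuple A w z :=
    pairTuple_ext A (mapLin_eqToHom_rfl A rfl w)
      (mapLin_eqToHom_rfl A rfl z)
  have ho : ∀ u, outerTuple A (isSplice_snd a b c d) (tripleTuple A v w z) u =
      pairTuple A v u := fun u =>
    pairTuple_ext A (mapLin_eqToHom_rfl A rfl v)
      (mapLin_eqToHom_rfl A rfl u)
  rw [endComp_apply, hi, ho]

/-- `pushTuple_perm` is indexed by the source of the permutation, so target entries `0, 1, 2` are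
computed at source indices `0, 2, 1`. -/
lemma pushTuple_swapHom {a b c : C} (v : A.obj a) (w : A.obj c) (z : A.obj b) :
    pushTuple A (swapHom a b c) (tripleTuple A v w z) = tripleTuple A v z w :=
  tripleTuple_ext A
    ((pushTuple_perm A (swapHom a b c) (tripleTuple A v w z) (0 : Fin 3)).trans
      (mapLin_eqToHom_rfl A rfl v))
    ((pushTuple_perm A (swapHom a b c) (tripleTuple A v w z) (2 : Fin 3)).trans
      (mapLin_eqToHom_rfl A rfl z))
    ((pushTuple_perm A (swapHom a b c) (tripleTuple A v w z) (1 : Fin 3)).trans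
      (mapLin_eqToHom_rfl A rfl w))

lemma pushTuple_homOfFamily {n : ℕ} {c' c : Fin n → C} (f : ∀ i, c' i ⟶ c i)
    (v : ∀ j, A.obj (c' j)) (j : Fin n) :
    pushTuple A (Tup.homOfFamily f) v j = mapLin A (f j) (v j) :=
  pushTuple_perm A (Tup.homOfFamily f) v j

lemma pushTuple_pairHom {a b a' b' : C} (f : a ⟶ a') (g : b ⟶ b') (v : A.obj a) (w : A.obj b) :
    pushTuple A (Tup.homOfFamily (pairHom f g)) (pairTuple A v w) =
      pairTuple A (mapLin A f v) (mapLin A g w) :=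
  pairTuple_ext A
    (pushTuple_homOfFamily A (pairHom f g) (pairTuple A v w) 0)
    (pushTuple_homOfFamily A (pairHom f g) (pairTuple A v w) 1)

end Binary

/-! ### Evaluating actions and compositions in an algebra. -/

section Eval

variable {k : Type u} [Field k] {C : Type u} [SmallCategory C] {P : COperad k C} (A : P.Algebra)

lemma COperad.Algebra.eval_act {a b : Tup C} {x y : C} (f : b ⟶ a) (g : x ⟶ y)
    (p : P.coll.val a x) (v : ∀ j, A.functor.obj (b.col j)) :
    A.eval (P.coll.act f g p) v = mapLin A.functor g (A.eval p (pushTuple A.functor f v)) :=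
  congrArg (fun φ : EndVal A.functor b y => φ v) (COperad.Hom.apply_act A.structureMap f g p)

lemma COperad.Algebra.eval_comp {a : Tup C} {i : Fin a.len} {b : Tup C} {y : C} {t : Tup C}
    (s : IsSplice a i b y t) (x : C) (p : P.coll.val a x) (q : P.coll.val b y) :
    A.eval (P.comp s x p q) = endComp A.functor s x (A.eval p) (A.eval q) :=
  COperad.Hom.apply_comp A.structureMap s x p q

end Eval

/-! ### Compatibility of natural transformations with tuples. -/

section NatTrans

variable {k : Type u} [Field k] {C : Type u} [SmallCategory C] {A B : C ⥤ ModuleCat.{u} k}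
  (η : A ⟶ B)

lemma natTrans_mapLin {x y : C} (f : x ⟶ y) (v : A.obj x) :
    (η.app y).hom (mapLin A f v) = mapLin B f ((η.app x).hom v) :=
  LinearMap.congr_fun (congrArg ModuleCat.Hom.hom (η.naturality f)) v

lemma natTrans_pairTuple {a b : C} (v : A.obj a) (w : A.obj b) :
    (fun j => (η.app ((⟨2, ![a, b]⟩ : Tup C).col j)).hom (pairTuple A v w j)) =
      pairTuple B ((η.app a).hom v) ((η.app b).hom w) :=
  pairTuple_ext B rfl rfl

lemma natTrans_pushTuple {a b : Tup C} (f : b ⟶ a) (v : ∀ j, A.obj (b.col j)) :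
    (fun j => (η.app (a.col j)).hom (pushTuple A f v j)) =
      pushTuple B f fun j => (η.app (b.col j)).hom (v j) :=
  funext fun _ => natTrans_mapLin η _ _

variable {a : Tup C} {i : Fin a.len} {b : Tup C} {y : C} {t : Tup C} (s : IsSplice a i b y t)

lemma natTrans_innerTuple (v : ∀ j, A.obj (t.col j)) :
    (fun j => (η.app (b.col j)).hom (innerTuple A s v j)) =
      innerTuple B s fun j => (η.app (t.col j)).hom (v j) :=
  funext fun _ => natTrans_mapLin η _ _

/-- Every entry of the outer tuple is a transported entry of `v` or the transported `w`, and
naturality passes through transports. This and `natTrans_innerTuple` settle the composition case of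
`natTrans_eval`. -/
lemma natTrans_outerTuple (v : ∀ j, A.obj (t.col j)) (w : A.obj y) :
    (fun j => (η.app (a.col j)).hom (outerTuple A s v w j)) =
      outerTuple B s (fun j => (η.app (t.col j)).hom (v j)) ((η.app y).hom w) := by
  funext j
  by_cases h : j = i
  · subst h
    rw [outerTuple_self, outerTuple_self, natTrans_mapLin]
  · rw [outerTuple_ne A s _ _ h, outerTuple_ne B s _ _ h, natTrans_mapLin]

end NatTrans

/-! ### Equality of algebras and of their morphisms. -/

section AlgebraHom

variable {k : Type u} [Field k] {C : Type u} [SmallCategory C] {P : COperad k C}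

lemma COperad.Algebra.eq_of_structureMap {F : C ⥤ ModuleCat.{u} k} {f g : P ⟶ endOperad F}
    (h : ∀ (a : Tup C) (x : C) (p : P.coll.val a x),
      COperad.Hom.apply f p = COperad.Hom.apply g p) :
    (⟨F, f⟩ : P.Algebra) = ⟨F, g⟩ :=
  congrArg (COperad.Algebra.mk F) (COperad.Hom.ext_apply h)

/-- Equality of functors requires comparing morphisms whose sources and targets are only
propositionally equal; this reduces the comparison to the underlying natural transformations. -/
lemma COperad.Algebra.hom_heq {A A' B B' : P.Algebra} (hA : A = A') (hB : B = B') (f : A ⟶ B)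
    (g : A' ⟶ B')
    (h : HEq (COperad.Algebra.Hom.toNatTrans f) (COperad.Algebra.Hom.toNatTrans g)) :
    HEq f g := by
  subst hA hB
  exact heq_of_eq (COperad.Algebra.Hom.ext (eq_of_heq h))

end AlgebraHom

/-! ### Generators and relations of the operad `H_O`. -/

section Generation

variable (k : Type u) [Field k] {O : Type u} [SmallCategory O] [GradedOperadicCategory O]

/-- The basis element with maps `f` and `π` is the image, under the action of these maps on `X`, of
the symbol with identity maps, and `gen` commutes with this action. -/
lemma gen_single {F T S : O} (φ : Elementary F T S) {c : Fin 2 → (Core O)ᵒᵖ} {t : (Core O)ᵒᵖ}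
    (f : ∀ i, c i ⟶ ![colorOf S, colorOf F] i) (π : colorOf T ⟶ t) :
    FreeOperad.gen (generators k O) c t (Submodule.Quotient.mk
      (Finsupp.single (⟨ElementarySymbol.star φ, f, π⟩ :
        FreeAction (ElementarySymbol O) 2 c t) (1 : k))) =
      (FreeOperad (generators k O)).coll.act (Tup.homOfFamily f) π (starOp k φ) := by
  refine Eq.trans ?_ (FreeOperad.gen_map f π _)
  refine congrArg (FreeOperad.gen (generators k O) c t)
    (congrArg (Submodule.Quotient.mk (p := relSpan _ _ _ _)) ?_)
  refine Eq.symm ((Finsupp.mapDomain_single (M := k)).trans ?_)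
  refine congrArg (fun e : FreeAction (ElementarySymbol O) 2 c t => Finsupp.single e (1 : k)) ?_
  -- The action composes with the identities attached to the symbol, and these have to be cancelled
  -- one input at a time.
  have h : ∀ i, f i ≫ pairHom (𝟙 (colorOf S)) (𝟙 (colorOf F)) i = f i := fun i => by
    match i with
    | 0 => exact Category.comp_id _
    | 1 => exact Category.comp_id _
  exact congrArg₂ (fun f' π' => (⟨ElementarySymbol.star φ, f', π'⟩ :
    FreeAction (ElementarySymbol O) 2 c t)) (funext h) (Category.id_comp π)

/-- The operation of the operad `H_O` given by an elementary morphism. -/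
noncomputable def starClass {F T S : O} (φ : Elementary F T S) :
    (hyperoperad k O).coll.val ⟨2, ![colorOf S, colorOf F]⟩ (colorOf T) :=
  (FreeOperad (generators k O)).quotientMk _ _ _ (starOp k φ)

/-- This is the relation `Eq` of the collection `Q`, already valid in the free operad and then
projected to the quotient. -/
lemma starClass_equivariance {F' T' S' F'' T'' S'' : O} (φ' : Elementary F' T' S')
    (φ'' : Elementary F'' T'' S'') (ω : T' ≅ T'') (σ : S' ≅ S'') (hσ : IsQuasibijection σ.hom)
    (w : φ'.hom ≫ σ.hom = ω.hom ≫ φ''.hom) :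
    (hyperoperad k O).coll.act (Tup.homOfFamily (pairHom (𝟙 _) (𝟙 _))) (colorHom ω)
        (starClass k φ'') =
      (hyperoperad k O).coll.act (Tup.homOfFamily
        (pairHom (colorHom σ) (colorHom (φ'.fiberIso φ'' ω σ.hom hσ w)))) (𝟙 _)
        (starClass k φ') := by
  have h : (FreeOperad (generators k O)).coll.act (Tup.homOfFamily (pairHom (𝟙 _) (𝟙 _)))
      (colorHom ω) (starOp k φ'') = (FreeOperad (generators k O)).coll.act (Tup.homOfFamily
        (pairHom (colorHom σ) (colorHom (φ'.fiberIso φ'' ω σ.hom hσ w)))) (𝟙 _)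
        (starOp k φ') := by
    rw [← gen_single, ← gen_single]
    -- The generating pair is used without transport: the morphism in `relSpan` is an identity,
    -- whose action is removed by `hid`.
    refine congrArg (FreeOperad.gen (generators k O) _ _)
      ((Submodule.Quotient.eq (relSpan _ _ _ _)).mpr (Submodule.subset_span
        ⟨_, _, 𝟙 _, _, _, SymbolRel.equivariance φ' φ'' ω σ hσ w, ?_⟩))
    have hid : ∀ r, ((symbolCollection k O 2).map
        (𝟙 ((fun i => op (![colorOf S'', colorOf F''] i), colorOf T') : _ × _))).hom r = r :=
      fun r => by
        rw [CategoryTheory.Functor.map_id]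
        rfl
    exact congrArg₂ (· - ·) (hid _).symm (hid _).symm
  exact congrArg ((FreeOperad (generators k O)).quotientMk _ _ _) h

/-- The difference of the two sides is represented by a generator of the ideal; the same reason
gives `starClass_parallel`. -/
lemma starClass_sequential {F T S G P : O} (φ : Elementary F T S) (ψ : Elementary G S P)
    (h : cardMap ψ.hom φ.idx = ψ.idx) :
    (hyperoperad k O).comp (isSplice_fst _ _ _ _) _ (starClass k φ) (starClass k ψ) =
      (hyperoperad k O).comp (isSplice_snd _ _ _ _) _ (starClass k (φ.comp ψ h))
        (starClass k (φ.onFiber ψ h)) :=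
  (Submodule.Quotient.eq _).mpr
    (COperad.subset_idealSpan _ _ _ (IsAssociator.sequential φ ψ h))

lemma starClass_parallel {F' F'' T P' P'' S : O} (φ' : Elementary F' T P')
    (ψ' : Elementary F'' P' S) (φ'' : Elementary F'' T P'') (ψ'' : Elementary F' P'' S)
    (w : φ'.hom ≫ ψ'.hom = φ''.hom ≫ ψ''.hom) (h' : cardMap ψ'.hom φ'.idx = ψ''.idx)
    (h'' : cardMap ψ''.hom φ''.idx = ψ'.idx) (hne : ψ'.idx ≠ ψ''.idx) :
    (hyperoperad k O).comp (isSplice_fst _ _ _ _) _ (starClass k φ') (starClass k ψ') =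
      (hyperoperad k O).coll.act (swapHom _ _ _) (𝟙 _)
        ((hyperoperad k O).comp (isSplice_fst _ _ _ _) _ (starClass k φ'') (starClass k ψ'')) :=
  (Submodule.Quotient.eq _).mpr
    (COperad.subset_idealSpan _ _ _ (IsAssociator.parallel φ' ψ' φ'' ψ'' w h' h'' hne))

variable {k}

/-- The operations `[*_φ]` generate the operad `H_O`. -/
lemma hyperoperad_induction
    {motive : ∀ {a : Tup (Core O)ᵒᵖ} {x : (Core O)ᵒᵖ}, (hyperoperad k O).coll.val a x → Prop}
    (star : ∀ {F T S : O} (φ : Elementary F T S), motive (starClass k φ))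
    (zero : ∀ {a : Tup (Core O)ᵒᵖ} {x : (Core O)ᵒᵖ},
      motive (0 : (hyperoperad k O).coll.val a x))
    (add : ∀ {a : Tup (Core O)ᵒᵖ} {x : (Core O)ᵒᵖ} (p q : (hyperoperad k O).coll.val a x),
      motive p → motive q → motive (p + q))
    (smul : ∀ {a : Tup (Core O)ᵒᵖ} {x : (Core O)ᵒᵖ} (r : k)
      (p : (hyperoperad k O).coll.val a x), motive p → motive (r • p))
    (act : ∀ {a b : Tup (Core O)ᵒᵖ} {x y : (Core O)ᵒᵖ} (f : b ⟶ a) (g : x ⟶ y)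
      (p : (hyperoperad k O).coll.val a x), motive p →
      motive ((hyperoperad k O).coll.act f g p))
    (comp : ∀ {a : Tup (Core O)ᵒᵖ} {i : Fin a.len} {b : Tup (Core O)ᵒᵖ} {y : (Core O)ᵒᵖ}
      {t : Tup (Core O)ᵒᵖ} (s : IsSplice a i b y t) (x : (Core O)ᵒᵖ)
      (p : (hyperoperad k O).coll.val a x) (q : (hyperoperad k O).coll.val b y),
      motive p → motive q → motive ((hyperoperad k O).comp s x p q))
    {a : Tup (Core O)ᵒᵖ} {x : (Core O)ᵒᵖ} (p : (hyperoperad k O).coll.val a x) : motive p := by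
  obtain ⟨p, rfl⟩ := (FreeOperad (generators k O)).quotientMk_surjective _ a x p
  obtain ⟨p, rfl⟩ : ∃ q : FreePre (generators k O) a x, FreeVal.mk q = p :=
    FreeVal.mk_surjective p
  -- Induction on a formal expression that represents the operation. All constructors but `gen`
  -- match a closure hypothesis by computation.
  induction p with
  | @gen n c x p =>
    obtain ⟨p, rfl⟩ := Submodule.Quotient.mk_surjective _ p
    -- A generator is the class of a finite combination of symbols with attached maps. Linearity of
    -- `L` reduces to one such symbol, and `gen_single` exhibits it as an action on some `starClass
    -- k φ`.
    let L : (FreeAction (ElementarySymbol O) n c x →₀ k) →ₗ[k]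
        (hyperoperad k O).coll.val ⟨n, c⟩ x :=
      ((FreeOperad (generators k O)).quotientMk _ _ _).comp
        ((FreeOperad.gen (generators k O) c x).comp (Submodule.mkQ
          (relSpan (symbolCollection k O) (SymbolRel k) n (fun i => op (c i), x))))
    change motive (L p)
    induction p using Finsupp.induction_linear with
    | zero =>
      rw [map_zero]
      exact zero
    | add p q hp hq =>
      rw [map_add]
      exact add _ _ hp hq
    | single e r =>
      have hr : Finsupp.single e r = r • Finsupp.single e (1 : k) := by simp
      rw [hr, map_smul]
      refine smul r _ ?_
      obtain ⟨σ, f, π⟩ := e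
      cases σ with
      | star φ =>
        have h := congrArg ((FreeOperad (generators k O)).quotientMk
          ((FreeOperad (generators k O)).idealSpan fun a x => {p | IsAssociator k a x p}) _ _)
          (gen_single k φ f π)
        exact h ▸ act (Tup.homOfFamily f) π _ (star φ)
  | zero => exact zero
  | add p q hp hq => exact add _ _ hp hq
  | smul r p hp => exact smul r _ hp
  | act f g p hp => exact act f g _ hp
  | comp s p q hp hq => exact comp s _ _ _ hp hq

/-- A natural transformation between algebras which commutes with the operations `[*_φ]` commutes
with all operations. -/
lemma natTrans_eval {A B : (hyperoperad k O).Algebra} (η : A.functor ⟶ B.functor)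
    (h : ∀ {F T S : O} (φ : Elementary F T S) (s : A.functor.obj (colorOf S))
      (f : A.functor.obj (colorOf F)),
      (η.app (colorOf T)).hom (A.eval (starClass k φ) (pairTuple A.functor s f)) =
        B.eval (starClass k φ) (pairTuple B.functor ((η.app _).hom s) ((η.app _).hom f)))
    {a : Tup (Core O)ᵒᵖ} {x : (Core O)ᵒᵖ} (p : (hyperoperad k O).coll.val a x)
    (v : ∀ j, A.functor.obj (a.col j)) :
    (η.app x).hom (A.eval p v) = B.eval p fun j => (η.app (a.col j)).hom (v j) := by
  -- In a composite, the outer and inner operations are evaluated on tuples other than `v`, so the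
  -- induction must quantify over all tuples.
  revert v
  refine hyperoperad_induction (motive := fun {a x} p => ∀ v : ∀ j, A.functor.obj (a.col j),
    (η.app x).hom (A.eval p v) = B.eval p fun j => (η.app (a.col j)).hom (v j))
    ?_ ?_ ?_ ?_ ?_ ?_ p
  · intro F T S φ v
    obtain ⟨s, f, rfl⟩ := exists_pairTuple A.functor v
    rw [h]
    exact congrArg (B.eval (starClass k φ)) (natTrans_pairTuple η s f).symm
  · intro a x v
    simp only [COperad.Algebra.eval, map_zero]
    exact map_zero (η.app x).hom
  · intro a x p q hp hq v
    have hp := hp v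
    have hq := hq v
    simp only [COperad.Algebra.eval] at hp hq ⊢
    rw [map_add, map_add]
    exact (map_add (η.app x).hom _ _).trans (congrArg₂ (· + ·) hp hq)
  · intro a x r p hp v
    have hp := hp v
    simp only [COperad.Algebra.eval] at hp ⊢
    rw [map_smul, map_smul]
    exact (map_smul (η.app x).hom _ _).trans (congrArg (r • ·) hp)
  · intro a b x y f g p hp v
    rw [A.eval_act, B.eval_act, natTrans_mapLin, hp, natTrans_pushTuple]
  · intro a i b y t s x p q hp hq v
    rw [A.eval_comp, B.eval_comp, endComp_apply, endComp_apply, hp, natTrans_outerTuple, hq,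
      natTrans_innerTuple]

end Generation

/-! ### The isomorphism between algebras of `H_O` and Markl operads. -/

section Equivalence

variable {k : Type u} [Field k] {O : Type u} [SmallCategory O] [GradedOperadicCategory O]

/-- The Markl operad of an algebra of the operad `H_O`. -/
noncomputable def COperad.Algebra.toMarkl (A : (hyperoperad k O).Algebra) : MarklOperad k O where
  functor := A.functor
  circ φ := toBilinear A.functor (A.eval (starClass k φ))
  -- Each of the three axioms is the corresponding identity among the classes `starClass k φ`,
  -- evaluated on a pair or a triple of vectors.
  equivariance φ' φ'' ω σ hσ w s f := by
    have h := congrArg (fun p => A.eval p (pairTuple A.functor s f))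
      (starClass_equivariance k φ' φ'' ω σ hσ w)
    dsimp only at h
    rw [A.eval_act, A.eval_act, pushTuple_pairHom, pushTuple_pairHom, mapLin_id, mapLin_id,
      mapLin_id] at h
    exact h
  sequential φ ψ hi p g f := by
    have h := congrArg (fun q => A.eval q (tripleTuple A.functor p g f))
      (starClass_sequential k φ ψ hi)
    dsimp only at h
    rw [A.eval_comp, A.eval_comp, endComp_fst, endComp_snd] at h
    exact h
  parallel φ' ψ' φ'' ψ'' w h' h'' hne s f'' f' := by
    have h := congrArg (fun q => A.eval q (tripleTuple A.functor s f'' f'))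
      (starClass_parallel k φ' ψ' φ'' ψ'' w h' h'' hne)
    dsimp only at h
    rw [A.eval_act, A.eval_comp, A.eval_comp, pushTuple_swapHom, endComp_fst, endComp_fst,
      mapLin_id] at h
    exact h

namespace MarklOperad

variable (M : MarklOperad k O)

/-- The operation of the endomorphism operad by which a symbol acts on a Markl operad. -/
def symbolValue : ∀ {n : ℕ} {c : Fin n → (Core O)ᵒᵖ} {x : (Core O)ᵒᵖ},
    ElementarySymbol O n c x → (endOperad M.functor).coll.val ⟨n, c⟩ x
  | _, _, _, .star φ => ofBilinear M.functor (M.circ φ)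

/-- This explicit formula turns the relation `SymbolRel` into the equivariance axiom in
`generatorsMap`, and with identity maps it yields `lift_starOp`. -/
lemma lift_symbolElem {F T S : O} (φ : Elementary F T S) {s f t : (Core O)ᵒᵖ}
    (σ : s ⟶ colorOf S) (τ : f ⟶ colorOf F) (π : colorOf T ⟶ t) (v : M.functor.obj s)
    (w : M.functor.obj f) :
    (show EndVal M.functor ⟨2, ![s, f]⟩ t from
      (freeCollectionLift (k := k) M.symbolValue).app ![s, f] t (symbolElem k φ σ τ π))
        (pairTuple M.functor v w) =
      mapLin M.functor π (M.circ φ (mapLin M.functor σ v) (mapLin M.functor τ w)) := by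
  have h := freeCollectionLift_single (k := k) M.symbolValue
    (⟨ElementarySymbol.star φ, pairHom σ τ, π⟩ : FreeAction (ElementarySymbol O) 2 ![s, f] t)
  refine (congrArg (fun p : EndVal M.functor ⟨2, ![s, f]⟩ t => p (pairTuple M.functor v w))
    h).trans ?_
  refine (endAct_apply M.functor _ π _ _).trans ?_
  exact congrArg (fun u => mapLin M.functor π (ofBilinear M.functor (M.circ φ) u))
    (pushTuple_pairHom M.functor σ τ v w)

/-- The action of the generators of `H_O` on a Markl operad. -/
noncomputable def generatorsMap : (generators k O).HomTo (endOperad M.functor) :=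
  quotientCollectionLift (freeCollectionLift M.symbolValue) (by
    rintro n c x p q ⟨φ', φ'', ω, σ, hσ, w⟩
    refine MultilinearMap.ext fun v => ?_
    obtain ⟨s, f, rfl⟩ := exists_pairTuple M.functor v
    refine (M.lift_symbolElem φ'' _ _ _ s f).trans
      (Eq.trans ?_ (M.lift_symbolElem φ' _ _ _ s f).symm)
    rw [mapLin_id, mapLin_id, mapLin_id]
    exact M.equivariance φ' φ'' ω σ hσ w s f)

lemma lift_starOp {F T S : O} (φ : Elementary F T S) :
    COperad.Hom.apply (FreeOperad.lift M.generatorsMap) (starOp k φ) =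
      ofBilinear M.functor (M.circ φ) := by
  refine MultilinearMap.ext fun v => ?_
  obtain ⟨s, f, rfl⟩ := exists_pairTuple M.functor v
  refine (M.lift_symbolElem φ _ _ _ s f).trans ?_
  rw [mapLin_id, mapLin_id, mapLin_id]
  rfl

/-- On a triple of vectors the two terms of an associator become the two sides of the sequential or
parallel axiom. Hence the ideal of associators lies in the kernel and the action descends to `H_O`.
-/
lemma lift_associator {a : Tup (Core O)ᵒᵖ} {x : (Core O)ᵒᵖ}
    {p : (FreeOperad (generators k O)).coll.val a x} (hp : IsAssociator k a x p) :
    COperad.Hom.apply (FreeOperad.lift M.generatorsMap) p = 0 := by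
  cases hp with
  | sequential φ ψ h =>
    rw [map_sub, COperad.Hom.apply_comp, COperad.Hom.apply_comp, lift_starOp, lift_starOp,
      lift_starOp, lift_starOp, sub_eq_zero]
    refine MultilinearMap.ext fun v => ?_
    obtain ⟨p, g, f, rfl⟩ := exists_tripleTuple M.functor v
    refine (endComp_fst M.functor _ _ p g f).trans
      (Eq.trans ?_ (endComp_snd M.functor _ _ p g f).symm)
    exact M.sequential φ ψ h p g f
  | parallel φ' ψ' φ'' ψ'' w h' h'' hne =>
    rw [map_sub, COperad.Hom.apply_act, COperad.Hom.apply_comp, COperad.Hom.apply_comp,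
      lift_starOp, lift_starOp, lift_starOp, lift_starOp, sub_eq_zero]
    refine MultilinearMap.ext fun v => ?_
    obtain ⟨s, f'', f', rfl⟩ := exists_tripleTuple M.functor v
    refine (endComp_fst M.functor _ _ s f'' f').trans
      (Eq.trans ?_ (endAct_apply M.functor _ _ _ _).symm)
    -- The swap feeds `s, f', f''` to the second composite, the order in which the right side of the
    -- parallel axiom takes its arguments.
    rw [pushTuple_swapHom, mapLin_id]
    refine Eq.trans ?_ (endComp_fst M.functor _ _ s f' f'').symm
    exact M.parallel φ' ψ' φ'' ψ'' w h' h'' hne s f'' f'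

/-- The algebra of the operad `H_O` given by a Markl operad. -/
noncomputable def toAlgebra : (hyperoperad k O).Algebra where
  functor := M.functor
  structureMap := COperad.quotientLift _ (FreeOperad.lift M.generatorsMap)
    (COperad.idealSpan_le fun _ _ _ hp => M.lift_associator hp)

lemma toAlgebra_eval_starClass {F T S : O} (φ : Elementary F T S) :
    M.toAlgebra.eval (starClass k φ) = ofBilinear M.functor (M.circ φ) :=
  M.lift_starOp φ

/-- The axioms are propositions, so only the functor and the operations matter. `HEq` is needed
because the type of `circ` depends on the functor. -/
lemma eq_of_circ {M N : MarklOperad k O}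
    (hM : M.functor = N.functor)
    (h : ∀ {F T S : O} (φ : Elementary F T S), HEq (M.circ φ) (N.circ φ)) : M = N := by
  obtain ⟨F, c, _, _, _⟩ := M
  obtain ⟨F', c', _, _, _⟩ := N
  obtain rfl : F = F' := hM
  have hc : @c = @c' := by
    funext F T S φ
    exact eq_of_heq (h φ)
  subst hc
  rfl

/-- The functor is unchanged by definition, and `∘_φ` is recovered because `starClass k φ` was made
to act by it. -/
lemma toMarkl_toAlgebra : M.toAlgebra.toMarkl = M :=
  eq_of_circ rfl fun φ => heq_of_eq (by
    refine LinearMap.ext fun s => LinearMap.ext fun f => ?_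
    exact congrArg (fun p : EndVal M.functor _ _ => p (pairTuple M.functor s f))
      (M.toAlgebra_eval_starClass φ))

lemma hom_heq {M M' N N' : MarklOperad k O} (hM : M = M') (hN : N = N') (f : M ⟶ N)
    (g : M' ⟶ N') (h : HEq (MarklOperad.Hom.toNatTrans f) (MarklOperad.Hom.toNatTrans g)) :
    HEq f g := by
  subst hM hN
  exact heq_of_eq (MarklOperad.Hom.ext (eq_of_heq h))

end MarklOperad

/-- Both structure maps land in the endomorphism operad of the same functor and agree on the classes
`starClass k φ`. Since these generate `H_O`, the maps coincide. -/
lemma toAlgebra_toMarkl (A : (hyperoperad k O).Algebra) : A.toMarkl.toAlgebra = A := by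
  refine COperad.Algebra.eq_of_structureMap fun a x p => ?_
  refine hyperoperad_induction (motive := fun {a x} p =>
    COperad.Hom.apply A.toMarkl.toAlgebra.structureMap p = COperad.Hom.apply A.structureMap p)
    ?_ ?_ ?_ ?_ ?_ ?_ p
  · intro F T S φ
    exact (A.toMarkl.toAlgebra_eval_starClass φ).trans (ofBilinear_toBilinear A.functor _)
  · intro a x
    exact (map_zero _).trans (map_zero _).symm
  · intro a x p q hp hq
    exact (map_add _ _ _).trans ((congrArg₂ (· + ·) hp hq).trans (map_add _ _ _).symm)
  · intro a x r p hp
    exact (map_smul _ _ _).trans ((congrArg (r • ·) hp).trans (map_smul _ _ _).symm)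
  · intro a b x y f g p hp
    exact (COperad.Hom.apply_act _ f g p).trans
      ((congrArg ((endOperad A.functor).coll.act f g) hp).trans
        (COperad.Hom.apply_act A.structureMap f g p).symm)
  · intro a i b y t s x p q hp hq
    exact (COperad.Hom.apply_comp _ s x p q).trans
      ((congrArg₂ (fun p q => (endOperad A.functor).comp s x p q) hp hq).trans
        (COperad.Hom.apply_comp A.structureMap s x p q).symm)

variable (k O)

/-- The functor from the algebras of the operad `H_O` to Markl operads. -/
noncomputable def algebraToMarkl : (hyperoperad k O).Algebra ⥤ MarklOperad k O where
  obj A := A.toMarkl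
  map {A B} f := (⟨COperad.Algebra.Hom.toNatTrans f, fun φ s x =>
    (COperad.Algebra.Hom.map_eval f (starClass k φ) (pairTuple A.functor s x)).trans
      (congrArg (B.eval (starClass k φ))
        (natTrans_pairTuple (COperad.Algebra.Hom.toNatTrans f) s x))⟩ :
      MarklOperad.Hom A.toMarkl B.toMarkl)

/-- The functor from Markl operads to the algebras of the operad `H_O`. -/
noncomputable def marklToAlgebra : MarklOperad k O ⥤ (hyperoperad k O).Algebra where
  obj M := M.toAlgebra
  map {M N} f := (⟨MarklOperad.Hom.toNatTrans f,
    natTrans_eval (A := M.toAlgebra) (B := N.toAlgebra) _ fun {F T S} φ s x =>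
      (congrArg (fun p : EndVal M.functor ⟨2, ![colorOf S, colorOf F]⟩ (colorOf T) =>
        ((MarklOperad.Hom.toNatTrans f).app (colorOf T)).hom (p (pairTuple M.functor s x)))
        (M.toAlgebra_eval_starClass φ)).trans
      ((MarklOperad.Hom.map_circ f φ s x).trans
        (congrArg (fun p : EndVal N.functor ⟨2, ![colorOf S, colorOf F]⟩ (colorOf T) =>
          p (pairTuple N.functor (((MarklOperad.Hom.toNatTrans f).app (colorOf S)).hom s)
            (((MarklOperad.Hom.toNatTrans f).app (colorOf F)).hom x)))
          (N.toAlgebra_eval_starClass φ)).symm)⟩ : COperad.Algebra.Hom M.toAlgebra N.toAlgebra)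

/-- On morphisms both functors keep the underlying natural transformation, so after the equality on
objects nothing is left to compare: `HEq.rfl` suffices. The other composite is treated in the same
way. -/
lemma algebraToMarkl_comp_marklToAlgebra :
    algebraToMarkl k O ⋙ marklToAlgebra k O = 𝟭 (hyperoperad k O).Algebra :=
  CategoryTheory.Functor.hext toAlgebra_toMarkl fun A B f =>
    COperad.Algebra.hom_heq (toAlgebra_toMarkl A) (toAlgebra_toMarkl B)
      ((algebraToMarkl k O ⋙ marklToAlgebra k O).map f) f HEq.rfl

lemma marklToAlgebra_comp_algebraToMarkl :
    marklToAlgebra k O ⋙ algebraToMarkl k O = 𝟭 (MarklOperad k O) :=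
  CategoryTheory.Functor.hext MarklOperad.toMarkl_toAlgebra fun M N f =>
    MarklOperad.hom_heq M.toMarkl_toAlgebra N.toMarkl_toAlgebra
      ((marklToAlgebra k O ⋙ algebraToMarkl k O).map f) f HEq.rfl

end Equivalence

/-! ### The presentation of `H_O` is binary quadratic. -/

section BinaryQuadratic

variable (k : Type u) [Field k] (O : Type u) [SmallCategory O] [GradedOperadicCategory O]

/-- Symbols exist only in arity two, so in other arities the basis of `X` is empty, and the quotient
`Q` of the zero space is zero. -/
lemma subsingleton_generators {n : ℕ} (hn : n ≠ 2) (d : (Fin n → ((Core O)ᵒᵖ)ᵒᵖ) × (Core O)ᵒᵖ) :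
    Subsingleton ((generators k O n).obj d) := by
  have : IsEmpty (FreeAction (ElementarySymbol O) n (fun i => (d.1 i).unop) d.2) :=
    ⟨fun e => by
      obtain ⟨σ, _, _⟩ := e
      cases σ
      exact hn rfl⟩
  have : Subsingleton ((symbolCollection k O n).obj d) :=
    inferInstanceAs (Subsingleton
      (FreeAction (ElementarySymbol O) n (fun i => (d.1 i).unop) d.2 →₀ k))
  exact (Submodule.Quotient.mk_surjective (relSpan (symbolCollection k O) (SymbolRel k) n d)
    ).subsingleton

variable {k O}

lemma isWeight_starOp {F T S : O} (φ : Elementary F T S) :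
    FreeOperad.IsWeight (generators k O) 1 (starOp k φ) :=
  .gen _

lemma isWeight_sub {w : ℕ} {a : Tup (Core O)ᵒᵖ} {x : (Core O)ᵒᵖ}
    {p q : (FreeOperad (generators k O)).coll.val a x}
    (hp : FreeOperad.IsWeight (generators k O) w p)
    (hq : FreeOperad.IsWeight (generators k O) w q) :
    FreeOperad.IsWeight (generators k O) w (p - q) := by
  have h := hp.add (hq.smul (-1))
  rwa [neg_smul, one_smul, ← sub_eq_add_neg] at h

lemma isWeight_associator {a : Tup (Core O)ᵒᵖ} {x : (Core O)ᵒᵖ}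
    {p : (FreeOperad (generators k O)).coll.val a x} (hp : IsAssociator k a x p) :
    FreeOperad.IsWeight (generators k O) 2 p := by
  cases hp with
  | sequential φ ψ h =>
    exact isWeight_sub (.comp _ (isWeight_starOp _) (isWeight_starOp _))
      (.comp _ (isWeight_starOp _) (isWeight_starOp _))
  | parallel φ' ψ' φ'' ψ'' w h' h'' hne =>
    exact isWeight_sub (.comp _ (isWeight_starOp _) (isWeight_starOp _))
      (.act _ _ (.comp _ (isWeight_starOp _) (isWeight_starOp _)))

variable (k O)

/-- The defining presentation is already of the required form, so the isomorphism is the identity.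
-/
lemma hyperoperad_isBinaryQuadratic : (hyperoperad k O).IsBinaryQuadratic :=
  ⟨generators k O, fun a x => {p | IsAssociator k a x p},
    fun _ hn d => subsingleton_generators k O hn d, fun _ _ _ hp => isWeight_associator hp,
    ⟨Iso.refl _⟩⟩

end BinaryQuadratic

end HyperOp

theorem theoremB2 (k : Type u) [Field k] (O : Type u) [SmallCategory O]
    [HyperOp.GradedOperadicCategory O] (hO : HyperOp.IsBataninMarkl O) :
    (HyperOp.hyperoperad k O).IsBinaryQuadratic ∧
    ∃ (Φ : (HyperOp.hyperoperad k O).Algebra ⥤ HyperOp.MarklOperad k O)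
      (Ψ : HyperOp.MarklOperad k O ⥤ (HyperOp.hyperoperad k O).Algebra),
      Φ ⋙ Ψ = 𝟭 (HyperOp.hyperoperad k O).Algebra ∧ Ψ ⋙ Φ = 𝟭 (HyperOp.MarklOperad k O) :=
  ⟨HyperOp.hyperoperad_isBinaryQuadratic k O, HyperOp.algebraToMarkl k O,
    HyperOp.marklToAlgebra k O, HyperOp.algebraToMarkl_comp_marklToAlgebra k O,
    HyperOp.marklToAlgebra_comp_algebraToMarkl k O⟩
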